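/- All polytopes are nonempty convex hulls of finitely many points of some $\mathbb R^q$; two polytopes are combinatorially equivalent if their face lattices are isomorphic, and affinely isomorphic if an affine map of the ambient spaces restricts to a bijection between them. Let $P$ be an $n$-polytope. A special $m$-simplex of $P$ is a simplex $\Sigma$ spanned by $m+1$ affinely independent vertices of $P$ such that every facet of $P$ contains all but exactly one vertex of $\Sigma$. The basis polytope of $(P,\Sigma)$ is the image $\pi(P)$ under a surjective linear map $\pi$ whose kernel is the linear space parallel to the affine hull of $\Sigma$ (it is determined up to affine isomorphism). $P$ is meek with respect to $\Sigma$ if the affine hull of the union of all faces of $P$ that contain no vertex of $\Sigma$ has the same dimension as the basis polytope. For polytopes $S\subset\mathbb R^a$ and $Q\subset\mathbb R^b$, translated so that the origin is a relative interior point of each, the direct sum is $$S\oplus Q=\{(\lambda_1 v,\lambda_2 w)\in\mathbb R^{a+b} : v\in S,\ w\in Q,\ \lambda_1,\lambda_2\ge 0,\ \lambda_1+\lambda_2\le 1\},$$ and $\operatorname{pyr}K\subset\mathbb R^{d+1}$ is the convex hull of $K\times\{0\}$ and $(0,\dots,0,1)$ for $K\subset\mathbb R^d$; $\operatorname{pyr}^i$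 is its $i$-fold iterate. "$\operatorname{pyr}^i(\Sigma_j\oplus Q)$" below means such a polytope for some $j$-simplex $\Sigma_j\subset\mathbb R^j$ and some choice of the translations. Theorem. Let $1\le m<n$. 1. An $n$-polytope $P$ is meek with respect to some special $m$-simplex if and only if there are an $(n-m)$-polytope $Q$ and integers $i\ge 0$, $j>0$ with $i+j=m$ such that $P$ is affinely isomorphic to $\operatorname{pyr}^i(\Sigma_j\oplus Q)$. 2. In this statement $Q$ is the basis polytope: for an $n$-polytope $P$ and a polytope $Q$, $P$ is meek with respect to some special $m$-simplex whose basis polytope is affinely isomorphic to $Q$ if and only if $\dim Q=n-m$ and $P$ is affinely isomorphic to $\operatorname{pyr}^i(\Sigma_j\oplus Q)$ for some $i\ge0$, $j>0$ with $i+j=m$. 3. Combinatorially: let $Q$ be an $(n-m)$-polytope and $P$ an $n$-polytope. Then $P$ is combinatorially equivalent to an $n$-polytope that is meek with respect to a special $m$-simplex with basis polytope combinatorially equivalent to $Q$ if and only if $P$ is combinatorially equivalent to $\operatorname{pyr}^i(\Sigma_j\oplus Q)$ for some $i\ge0$, $j>0$ with $i+j=m$. 4. For every $(n-m)$-polytope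 $Q$ there are exactly $m$ combinatorial types of $n$-polytopes that are meek with respect to a special $m$-simplex with basis polytope combinatorially equivalent to $Q$. -/

import Mathlib

noncomputable section

namespace SpecialSimplex

/-- A (nonempty) convex polytope: the convex hull of finitely many points. -/
def IsPolytope {q : ℕ} (P : Set (Fin q → ℝ)) : Prop :=
  ∃ t : Finset (Fin q → ℝ), t.Nonempty ∧ P = convexHull ℝ (t : Set (Fin q → ℝ))

/-- The dimension of (the affine hull of) a nonempty set. -/
def dim {q : ℕ} (P : Set (Fin q → ℝ)) : ℕ :=
  Module.finrank ℝ (vectorSpan ℝ P)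

/-- The face lattice of `P`, ordered by inclusion. `IsExposed` allows `∅` and `P` itself. -/
abbrev FaceLattice {q : ℕ} (P : Set (Fin q → ℝ)) : Type :=
  {F : Set (Fin q → ℝ) // IsExposed ℝ P F}

/-- Combinatorial equivalence: isomorphic face lattices. -/
def CombEquiv {q r : ℕ} (P : Set (Fin q → ℝ)) (R : Set (Fin r → ℝ)) : Prop :=
  Nonempty (FaceLattice P ≃o FaceLattice R)

/-- Affine isomorphism of polytopes: an affine map between the ambient spaces that restricts
to a bijection between the two polytopes. -/
def AffEquiv {q r : ℕ} (P : Set (Fin q → ℝ)) (R : Set (Fin r → ℝ)) : Prop :=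
  ∃ f : (Fin q → ℝ) →ᵃ[ℝ] (Fin r → ℝ), Set.BijOn f P R

/-- A facet: a nonempty face of codimension one. -/
def IsFacet {q : ℕ} (P F : Set (Fin q → ℝ)) : Prop :=
  IsExposed ℝ P F ∧ F.Nonempty ∧ dim F + 1 = dim P

/-- `s` is the vertex set of a special `m`-simplex of `P`: it consists of `m + 1` affinely
independent vertices of `P`, and every facet of `P` contains all but exactly one of them. -/
def IsSpecialSimplex {q : ℕ} (m : ℕ) (P : Set (Fin q → ℝ)) (s : Finset (Fin q → ℝ)) : Prop :=
  s.card = m + 1 ∧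
  (s : Set (Fin q → ℝ)) ⊆ P.extremePoints ℝ ∧
  AffineIndependent ℝ (fun x : s => (x : Fin q → ℝ)) ∧
  ∀ F, IsFacet P F → ∃! x, x ∈ s ∧ x ∉ F

/-- `Q` is the basis polytope of `P` with respect to the simplex with vertex set `s`: the image
of `P` under a projection whose kernel is the linear space parallel to the affine hull of `s`. -/
def IsBasisPolytope {q d : ℕ} (P : Set (Fin q → ℝ)) (s : Finset (Fin q → ℝ))
    (Q : Set (Fin d → ℝ)) : Prop :=
  ∃ π : (Fin q → ℝ) →ₗ[ℝ] (Fin d → ℝ), Function.Surjective π ∧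
    LinearMap.ker π = vectorSpan ℝ (s : Set (Fin q → ℝ)) ∧ π '' P = Q

/-- The union of the faces of `P` that contain no element of `s`. -/
def restComplexSupport {q : ℕ} (P : Set (Fin q → ℝ)) (s : Finset (Fin q → ℝ)) :
    Set (Fin q → ℝ) :=
  ⋃₀ {F | IsExposed ℝ P F ∧ Disjoint F (s : Set (Fin q → ℝ))}

/-- `P` is meek with respect to `s`: the complex of the faces of `P` without vertices in `s`
has an affine hull of the same dimension as the basis polytope. -/
def IsMeek {q : ℕ} (P : Set (Fin q → ℝ)) (s : Finset (Fin q → ℝ)) : Prop :=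
  ∃ (d : ℕ) (Q : Set (Fin d → ℝ)), IsBasisPolytope P s Q ∧
    dim Q = dim (restComplexSupport P s)

/-- The direct sum of `S ⊆ ℝᵃ` and `Q ⊆ ℝᵇ` in `ℝᵃ⁺ᵇ`. -/
def directSum {a b : ℕ} (S : Set (Fin a → ℝ)) (Q : Set (Fin b → ℝ)) :
    Set (Fin (a + b) → ℝ) :=
  {x | ∃ v ∈ S, ∃ w ∈ Q, ∃ l₁ l₂ : ℝ, 0 ≤ l₁ ∧ 0 ≤ l₂ ∧ l₁ + l₂ ≤ 1 ∧
    x = Fin.append (l₁ • v) (l₂ • w)}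

/-- The pyramid over `K ⊆ ℝᵈ` with apex `(0, …, 0, 1)`. -/
def pyr {d : ℕ} (K : Set (Fin d → ℝ)) : Set (Fin (d + 1) → ℝ) :=
  convexHull ℝ (insert (Fin.snoc (α := fun _ => ℝ) (0 : Fin d → ℝ) 1)
    ((fun x : Fin d → ℝ => Fin.snoc (α := fun _ => ℝ) x 0) '' K))

/-- The `i`-fold pyramid. -/
def pyrIter {d : ℕ} (K : Set (Fin d → ℝ)) : (i : ℕ) → Set (Fin (d + i) → ℝ)
  | 0 => K
  | i + 1 => pyr (pyrIter K i)

/-- A `j`-dimensional simplex in `ℝʲ`. -/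
def IsSimplex {j : ℕ} (S : Set (Fin j → ℝ)) : Prop :=
  ∃ v : Fin (j + 1) → (Fin j → ℝ), AffineIndependent ℝ v ∧ S = convexHull ℝ (Set.range v)

/-- `R` is an `i`-fold pyramid over a direct sum of a `j`-simplex `S` and `Q`. As usual for
direct sums, both summands are first translated so that the origin is a (relative) interior
point of each of them. -/
def IsPyramidOverSum (i j : ℕ) {d : ℕ} (Q : Set (Fin d → ℝ))
    (R : Set (Fin (j + d + i) → ℝ)) : Prop :=
  ∃ (S : Set (Fin j → ℝ)) (b : Fin j → ℝ) (c : Fin d → ℝ),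
    IsSimplex S ∧ b ∈ intrinsicInterior ℝ S ∧ c ∈ intrinsicInterior ℝ Q ∧
    R = pyrIter (directSum ((fun x => x - b) '' S) ((fun x => x - c) '' Q)) i

/-- `P` is a meek `n`-polytope with a special `m`-simplex whose basis polytope is, up to
combinatorial equivalence, `Q`. -/
def IsMeekOver {d q : ℕ} (n m : ℕ) (Q : Set (Fin d → ℝ)) (P : Set (Fin q → ℝ)) : Prop :=
  IsPolytope P ∧ dim P = n ∧ ∃ s, IsSpecialSimplex m P s ∧ IsMeek P s ∧
    ∃ (e : ℕ) (B : Set (Fin e → ℝ)), IsBasisPolytope P s B ∧ CombEquiv B Q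

end SpecialSimplex

end

/-!
Both meek polytopes and iterated pyramids over direct sums with a simplex are convex hulls of a
simplex `Σ` and a polytope `C` of complementary dimension whose affine hulls meet in a single point
`p`; this point is relatively interior to `C` and lies in `Σ`, but is not a vertex of `Σ`. For a
meek polytope, `C` is the hull of the vertices outside `Σ`: a linear function that is constant on
`Σ` and not on `P` attains its maximum over `P` at no vertex of `Σ`, since otherwise some facet
would contain `Σ`. Hence `Σ` and `C` together span `P`, and meekness makes the spans independent.
The barycentric coordinates of `p` that vanish belong to the apices of the pyramids, the others to
the simplex of the direct sum.

A face of such a hull is determined by its vertices in `Σ` and its intersection with `C`, subject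
only to the condition that it contains the carrier of `p` in `Σ` exactly if it contains `C`. So the
face lattice depends only on that of `C` and on the number `i` of vanishing coordinates. If `C` has
`M ≥ 2` proper faces, counting `∅`, the number `2 ^ i + (2 ^ (m + 1) - 2 ^ i) * M` of faces
determines `i`.
-/

namespace SpecialSimplex

open Set

section Affine

variable {V W : Type*} [AddCommGroup V] [Module ℝ V] [AddCommGroup W] [Module ℝ W]

theorem affineMap_sum_smul {ι : Type*} [Fintype ι] (f : V →ᵃ[ℝ] W) (v : ι → V) {w : ι → ℝ}
    (hw : ∑ k, w k = 1) : f (∑ k, w k • v k) = ∑ k, w k • f (v k) := by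
  have h := Finset.map_affineCombination Finset.univ v w hw f
  simpa only [Finset.affineCombination_eq_linear_combination _ _ _ hw, Function.comp_apply] using h

theorem affineMap_linear_sub (f : V →ᵃ[ℝ] W) (x y : V) : f.linear (x - y) = f x - f y :=
  f.linearMap_vsub x y

theorem affineMap_le_of_mem_convexHull {T : Set V} {f : V →ᵃ[ℝ] ℝ} {c : ℝ}
    (h : ∀ x ∈ T, f x ≤ c) : ∀ x ∈ convexHull ℝ T, f x ≤ c :=
  convexHull_min h ((convex_Iic c).affine_preimage f)

theorem sep_eq_zero_convexHull {T : Set V} {f : V →ᵃ[ℝ] ℝ} (h : ∀ x ∈ T, f x ≤ 0) :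
    {x ∈ convexHull ℝ T | f x = 0} = convexHull ℝ {x ∈ T | f x = 0} := by
  refine Subset.antisymm ?_ fun x hx => ⟨convexHull_mono (fun y hy => hy.1) hx, ?_⟩
  · suffices hull : convexHull ℝ T ⊆
        {x | f x ≤ 0 ∧ (f x = 0 → x ∈ convexHull ℝ {x ∈ T | f x = 0})} from
      fun x hx => (hull hx.1).2 hx.2
    refine convexHull_min (fun x hx => ⟨h x hx, fun h0 => subset_convexHull ℝ _ ⟨hx, h0⟩⟩) ?_
    rw [convex_iff_forall_pos]
    rintro x ⟨hx, hx0⟩ y ⟨hy, hy0⟩ a b ha hb hab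
    have hf : f (a • x + b • y) = a * f x + b * f y := Convex.combo_affine_apply hab
    refine ⟨by rw [hf]; nlinarith, fun h0 => ?_⟩
    have hfx : f x = 0 := by nlinarith
    have hfy : f y = 0 := by nlinarith
    exact convex_convexHull ℝ _ (hx0 hfx) (hy0 hfy) ha.le hb.le hab
  · exact convexHull_min (fun y hy => hy.2) ((convex_singleton (0 : ℝ)).affine_preimage f) hx

theorem vectorSpan_le_iff {A : Set V} {U : Submodule ℝ V} :
    vectorSpan ℝ A ≤ U ↔ ∀ x ∈ A, ∀ y ∈ A, x - y ∈ U := by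
  rw [vectorSpan_def, Submodule.span_le]
  exact vsub_subset_iff

theorem vectorSpan_le_ker_iff {A : Set V} {l : V →ₗ[ℝ] W} :
    vectorSpan ℝ A ≤ LinearMap.ker l ↔ ∀ x ∈ A, ∀ y ∈ A, l x = l y := by
  simp only [vectorSpan_le_iff, LinearMap.mem_ker, map_sub, sub_eq_zero]

theorem le_of_forall_le_ker {U U' : Submodule ℝ V}
    (h : ∀ l : V →ₗ[ℝ] ℝ, U' ≤ LinearMap.ker l → U ≤ LinearMap.ker l) : U ≤ U' := by
  intro u hu
  by_contra hu'
  obtain ⟨l, hlu, hl⟩ := Submodule.exists_le_ker_of_notMem hu'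
  exact hlu (h l hl hu)

theorem vectorSpan_convexHull (A : Set V) : vectorSpan ℝ (convexHull ℝ A) = vectorSpan ℝ A := by
  rw [← direction_affineSpan, affineSpan_convexHull, direction_affineSpan]

theorem affineMap_linear_eqOn_vectorSpan {A : Set V} {f g : V →ᵃ[ℝ] W} (h : EqOn f g A) :
    EqOn f.linear g.linear (vectorSpan ℝ A) := by
  have hle : vectorSpan ℝ A ≤ LinearMap.ker (f.linear - g.linear) := by
    rw [vectorSpan_le_iff]
    intro x hx y hy
    rw [LinearMap.mem_ker, LinearMap.sub_apply, affineMap_linear_sub, affineMap_linear_sub, h hx,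
      h hy, sub_self]
  exact fun u hu => sub_eq_zero.mp (hle hu)

theorem affineMap_linear_eq_zero_of_mem_vectorSpan {A : Set V} {f : V →ᵃ[ℝ] W} {c : W}
    (h : ∀ x ∈ A, f x = c) {u : V} (hu : u ∈ vectorSpan ℝ A) : f.linear u = 0 :=
  (affineMap_linear_eqOn_vectorSpan (g := AffineMap.const ℝ V c) h hu).trans (by simp)

theorem affineMap_eqOn_affineSpan {A : Set V} {f g : V →ᵃ[ℝ] W} (h : EqOn f g A) :
    EqOn f g (affineSpan ℝ A) := by
  intro x hx
  obtain ⟨a, ha⟩ := (affineSpan_nonempty ℝ).mp ⟨x, hx⟩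
  have hxa : x - a ∈ vectorSpan ℝ A := by
    rw [← direction_affineSpan]
    exact AffineSubspace.vsub_mem_direction hx (subset_affineSpan ℝ A ha)
  have := affineMap_linear_eqOn_vectorSpan h hxa
  rwa [affineMap_linear_sub, affineMap_linear_sub, h ha, sub_left_inj] at this

theorem sum_smul_mem_affineSpan {ι : Type*} [Fintype ι] {v : ι → V} {w : ι → ℝ}
    (hw : ∑ k, w k = 1) : ∑ k, w k • v k ∈ affineSpan ℝ (range v) := by
  rw [← Finset.affineCombination_eq_linear_combination _ _ _ hw]
  exact affineCombination_mem_affineSpan hw v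

theorem finrank_map_of_injOn {U : Submodule ℝ V} {L : V →ₗ[ℝ] W} (h : InjOn L U) :
    Module.finrank ℝ (U.map L) = Module.finrank ℝ U := by
  rw [← LinearMap.range_domRestrict]
  exact LinearMap.finrank_range_of_inj fun x y hxy => Subtype.ext (h x.2 y.2 hxy)

theorem exists_affineMap_apply_eq {ι : Type*} [Finite ι] {v : ι → V}
    (hv : AffineIndependent ℝ v) (α : ι → W) : ∃ f : V →ᵃ[ℝ] W, ∀ k, f (v k) = α k := by
  classical
  cases nonempty_fintype ι
  -- The points `(v k, 1)` of `V × ℝ` are linearly independent.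
  let L : (ι → ℝ) →ₗ[ℝ] V × ℝ :=
    (Fintype.linearCombination ℝ v).prod (Fintype.linearCombination ℝ fun _ => (1 : ℝ))
  have hL : LinearMap.ker L = ⊥ := by
    rw [LinearMap.ker_eq_bot']
    intro w hw
    have hsmul : ∑ k, w k • v k = 0 := by
      simpa [L, Fintype.linearCombination_apply] using congrArg Prod.fst hw
    have hsum : ∑ k, w k = 0 := by
      simpa [L, Fintype.linearCombination_apply] using congrArg Prod.snd hw
    ext k
    exact affineIndependent_iff.mp hv Finset.univ w hsum hsmul k (Finset.mem_univ k)
  obtain ⟨g, hg⟩ := LinearMap.exists_leftInverse_of_injective L hL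
  refine ⟨((Fintype.linearCombination ℝ α) ∘ₗ g).toAffineMap.comp
    ((AffineMap.id ℝ V).prod (AffineMap.const ℝ V (1 : ℝ))), fun k => ?_⟩
  have hgk : g (v k, 1) = Pi.single k 1 := by
    have : L (Pi.single k 1) = (v k, 1) := by simp [L]
    rw [← this]
    exact LinearMap.congr_fun hg _
  simp [hgk]

theorem exists_affineMap_eqOn_eqOn {A B : Set V}
    (hAB : Disjoint (vectorSpan ℝ A) (vectorSpan ℝ B)) {p : V} (hpA : p ∈ affineSpan ℝ A)
    (hpB : p ∈ affineSpan ℝ B) {f g : V →ᵃ[ℝ] W} (hfg : f p = g p) :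
    ∃ h : V →ᵃ[ℝ] W, EqOn h f A ∧ EqOn h g B := by
  obtain ⟨U, hU, hc⟩ := hAB.exists_isCompl
  let L := LinearMap.ofIsCompl hc (f.linear.domRestrict U) (g.linear.domRestrict (vectorSpan ℝ B))
  have sub_mem : ∀ {S : Set V}, p ∈ affineSpan ℝ S → ∀ x ∈ S, x - p ∈ vectorSpan ℝ S :=
    fun hp x hx => by
      rw [← direction_affineSpan]
      exact AffineSubspace.vsub_mem_direction (subset_affineSpan ℝ _ hx) hp
  refine ⟨L.toAffineMap + AffineMap.const ℝ V (g p - L p), fun x hx => ?_, fun x hx => ?_⟩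
  · have hL : L (x - p) = f.linear (x - p) :=
      LinearMap.ofIsCompl_apply_left hc ⟨x - p, hU (sub_mem hpA x hx)⟩
    rw [map_sub, affineMap_linear_sub] at hL
    simp only [AffineMap.coe_add, Pi.add_apply, LinearMap.coe_toAffineMap, AffineMap.const_apply]
    rw [← hfg, add_sub_left_comm, hL, add_sub_cancel]
  · have hL : L (x - p) = g.linear (x - p) :=
      LinearMap.ofIsCompl_apply_right hc ⟨x - p, sub_mem hpB x hx⟩
    rw [map_sub, affineMap_linear_sub] at hL
    simp only [AffineMap.coe_add, Pi.add_apply, LinearMap.coe_toAffineMap, AffineMap.const_apply]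
    rw [add_sub_left_comm, hL, add_sub_cancel]

end Affine

section Faces

variable {E : Type*} [NormedAddCommGroup E] [NormedSpace ℝ E] {P F : Set E}

theorem isExposed_sep_eq_zero [FiniteDimensional ℝ E] {f : E →ᵃ[ℝ] ℝ} (h : ∀ x ∈ P, f x ≤ 0) :
    IsExposed ℝ P {x ∈ P | f x = 0} := by
  rintro ⟨z, hz, hfz⟩
  refine ⟨LinearMap.toContinuousLinearMap f.linear, ?_⟩
  have hlin : ∀ x y, f.linear y ≤ f.linear x ↔ f y ≤ f x := fun x y => by
    rw [← sub_nonneg, ← map_sub, affineMap_linear_sub, sub_nonneg]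
  ext x
  simp only [mem_ofPred_eq, LinearMap.coe_toContinuousLinearMap', hlin]
  exact and_congr_right fun hx => ⟨fun h0 y hy => h0 ▸ h y hy,
    fun hmax => le_antisymm (h x hx) (hfz ▸ hmax z hz)⟩

theorem exists_affineMap_of_isExposed (h : IsExposed ℝ P F) :
    ∃ f : E →ᵃ[ℝ] ℝ, (∀ x ∈ P, f x ≤ 0) ∧ F = {x ∈ P | f x = 0} := by
  rcases F.eq_empty_or_nonempty with rfl | hne
  · exact ⟨AffineMap.const ℝ _ (-1), fun x _ => by simp, by simp⟩
  · obtain ⟨l, rfl⟩ := h hne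
    obtain ⟨z, hz, hmax⟩ := hne
    refine ⟨(l : E →ₗ[ℝ] ℝ).toAffineMap - AffineMap.const ℝ _ (l z),
      fun x hx => by simpa using hmax x hx, ?_⟩
    ext x
    simp only [mem_ofPred_eq, AffineMap.coe_sub, Pi.sub_apply, LinearMap.coe_toAffineMap,
      ContinuousLinearMap.coe_coe, AffineMap.const_apply, sub_eq_zero]
    exact and_congr_right fun hx => ⟨fun hx' => le_antisymm (hmax x hx) (hx' z hz),
      fun heq y hy => heq ▸ hmax y hy⟩

theorem isExposed_image {E' : Type*} [NormedAddCommGroup E'] [NormedSpace ℝ E']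
    [FiniteDimensional ℝ E'] {f : E →ᵃ[ℝ] E'} {f' : E' →ᵃ[ℝ] E} (hf : LeftInvOn f' f P)
    (hF : IsExposed ℝ P F) : IsExposed ℝ (f '' P) (f '' F) := by
  obtain ⟨g, hg, rfl⟩ := exists_affineMap_of_isExposed hF
  have heq : f '' {x ∈ P | g x = 0} = {y ∈ f '' P | g.comp f' y = 0} := by
    ext y
    constructor
    · rintro ⟨x, ⟨hx, hgx⟩, rfl⟩
      exact ⟨mem_image_of_mem f hx, by simp [hf hx, hgx]⟩
    · rintro ⟨⟨x, hx, rfl⟩, h0⟩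
      exact ⟨x, ⟨hx, by simpa [hf hx] using h0⟩, rfl⟩
  rw [heq]
  apply isExposed_sep_eq_zero
  rintro _ ⟨x, hx, rfl⟩
  simpa [hf hx] using hg x hx

end Faces

section RelativeInterior

variable {E : Type*} [NormedAddCommGroup E] [NormedSpace ℝ E] {C : Set E} {p : E}

theorem exists_lineMap_mem_of_mem_intrinsicInterior (hp : p ∈ intrinsicInterior ℝ C) {z : E}
    (hz : z ∈ affineSpan ℝ C) : ∃ ε : ℝ, 0 < ε ∧ AffineMap.lineMap p z ε ∈ C := by
  obtain ⟨y, hy, rfl⟩ := mem_intrinsicInterior.mp hp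
  let φ : ℝ → affineSpan ℝ C := fun t => ⟨AffineMap.lineMap (y : E) z t,
    AffineMap.lineMap_mem t y.2 hz⟩
  have hφ : Continuous φ := AffineMap.lineMap_continuous.subtype_mk _
  have hφ0 : φ 0 = y := Subtype.ext (AffineMap.lineMap_apply_zero _ _)
  have hnhds : ∀ᶠ t in nhds (0 : ℝ), φ t ∈ interior ((↑) ⁻¹' C : Set (affineSpan ℝ C)) :=
    hφ.continuousAt.eventually_mem (by rw [hφ0]; exact isOpen_interior.mem_nhds hy)
  obtain ⟨ε, hεC, hε⟩ :=
    ((hnhds.filter_mono nhdsWithin_le_nhds).and (self_mem_nhdsWithin (s := Ioi (0 : ℝ)))).exists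
  have hmem : φ ε ∈ ((↑) ⁻¹' C : Set (affineSpan ℝ C)) := interior_subset hεC
  exact ⟨ε, hε, hmem⟩

theorem eq_of_le_of_mem_intrinsicInterior (hp : p ∈ intrinsicInterior ℝ C) {g : E →ᵃ[ℝ] ℝ}
    (hg : ∀ x ∈ C, g x ≤ g p) : ∀ x ∈ C, g x = g p := by
  intro x hx
  obtain ⟨ε, hε, hm⟩ := exists_lineMap_mem_of_mem_intrinsicInterior hp
    (AffineMap.lineMap_mem (-1 : ℝ) (subset_affineSpan ℝ C (intrinsicInterior_subset hp))
      (subset_affineSpan ℝ C hx))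
  have hle := hg _ hm
  rw [AffineMap.apply_lineMap, AffineMap.apply_lineMap, AffineMap.lineMap_apply_ring',
    AffineMap.lineMap_apply_ring'] at hle
  exact le_antisymm (hg x hx) (by nlinarith)

theorem mem_interior_of_forall_dual_eq (hC : Convex ℝ C) (hne : (interior C).Nonempty)
    (h : ∀ f : StrongDual ℝ E, (∀ x ∈ C, f x ≤ f p) → ∀ x ∈ C, f x = f p) : p ∈ interior C := by
  by_contra hp
  obtain ⟨f, hf⟩ := geometric_hahn_banach_open_point hC.interior isOpen_interior hp
  have hle : C ⊆ f ⁻¹' Iic (f p) := by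
    refine subset_closure.trans ?_
    rw [← hC.closure_interior_eq_closure_of_nonempty_interior hne]
    exact closure_minimal (fun a ha => (hf a ha).le) (isClosed_Iic.preimage f.continuous)
  obtain ⟨a, ha⟩ := hne
  exact (hf a ha).ne (h f hle a (interior_subset ha))

theorem add_mem_intrinsicInterior_iff (hp : p ∈ affineSpan ℝ C)
    (u : (affineSpan ℝ C).direction) : (u : E) + p ∈ intrinsicInterior ℝ C ↔
      u ∈ interior {u : (affineSpan ℝ C).direction | (u : E) + p ∈ C} := by
  have : Nonempty (affineSpan ℝ C) := ⟨⟨p, hp⟩⟩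
  let φ : (affineSpan ℝ C).direction ≃ₜ affineSpan ℝ C :=
    (ContinuousAffineEquiv.vaddConst ℝ (⟨p, hp⟩ : affineSpan ℝ C)).toHomeomorph
  have hφ : {u : (affineSpan ℝ C).direction | (u : E) + p ∈ C} = φ ⁻¹' ((↑) ⁻¹' C) := rfl
  rw [hφ, ← φ.preimage_interior, mem_preimage, mem_intrinsicInterior]
  refine ⟨?_, fun h => ⟨φ u, h, rfl⟩⟩
  rintro ⟨y, hy, hyu⟩
  rwa [show φ u = y from Subtype.ext hyu.symm]

theorem mem_intrinsicInterior_of_forall_affineMap_eq [FiniteDimensional ℝ E] (hC : Convex ℝ C)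
    (hp : p ∈ affineSpan ℝ C)
    (h : ∀ g : E →ᵃ[ℝ] ℝ, (∀ x ∈ C, g x ≤ g p) → ∀ x ∈ C, g x = g p) :
    p ∈ intrinsicInterior ℝ C := by
  let D := (affineSpan ℝ C).direction
  let C₀ : Set D := {u | (u : E) + p ∈ C}
  have sub_mem : ∀ x ∈ affineSpan ℝ C, x - p ∈ D := fun x hx =>
    AffineSubspace.vsub_mem_direction hx hp
  have hconv : Convex ℝ C₀ :=
    hC.affine_preimage (D.subtype.toAffineMap + AffineMap.const ℝ D p)
  have hne : (interior C₀).Nonempty := by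
    obtain ⟨z, hz⟩ := ((affineSpan_nonempty ℝ).mp ⟨p, hp⟩).intrinsicInterior hC
    have hzD := sub_mem z (subset_affineSpan ℝ C (intrinsicInterior_subset hz))
    exact ⟨⟨z - p, hzD⟩, (add_mem_intrinsicInterior_iff hp ⟨z - p, hzD⟩).mp (by simpa using hz)⟩
  suffices h0 : (0 : D) ∈ interior C₀ by
    simpa using (add_mem_intrinsicInterior_iff hp 0).mpr h0
  refine mem_interior_of_forall_dual_eq hconv hne fun f hf u hu => ?_
  obtain ⟨l, hl⟩ := LinearMap.exists_extend (f : D →ₗ[ℝ] ℝ)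
  have hlf : ∀ u : D, l u = f u := LinearMap.congr_fun hl
  have hle : ∀ x ∈ C, l x ≤ l p := fun x hx => by
    have hfx := hf ⟨x - p, sub_mem x (subset_affineSpan ℝ C hx)⟩ (by simpa [C₀] using hx)
    rwa [← hlf, map_sub, map_zero, sub_nonpos] at hfx
  have heq : l (u + p) = l p := h l.toAffineMap hle _ hu
  rwa [map_add, hlf, add_eq_right, ← map_zero f] at heq

theorem map_mem_intrinsicInterior_image {W : Type*} [NormedAddCommGroup W] [NormedSpace ℝ W]
    [FiniteDimensional ℝ W] (hC : Convex ℝ C) (hp : p ∈ intrinsicInterior ℝ C) (f : E →ᵃ[ℝ] W) :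
    f p ∈ intrinsicInterior ℝ (f '' C) := by
  refine mem_intrinsicInterior_of_forall_affineMap_eq (hC.affine_image f)
    (subset_affineSpan ℝ _ (mem_image_of_mem f (intrinsicInterior_subset hp))) fun g hg => ?_
  rw [forall_mem_image] at hg ⊢
  exact eq_of_le_of_mem_intrinsicInterior (g := g.comp f) hp hg

theorem affineMap_linear_injOn_vectorSpan {W : Type*} [AddCommGroup W] [Module ℝ W]
    [FiniteDimensional ℝ E] (hC : Convex ℝ C) {f : E →ᵃ[ℝ] W} (hf : InjOn f C) :
    InjOn f.linear (vectorSpan ℝ C) := by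
  rcases C.eq_empty_or_nonempty with rfl | hne
  · simp
  rw [← LinearMap.disjoint_ker_iff_injOn, Submodule.disjoint_def]
  intro u hu h0
  obtain ⟨p, hp⟩ := hne.intrinsicInterior hC
  have hpC := intrinsicInterior_subset hp
  obtain ⟨ε, hε, hm⟩ := exists_lineMap_mem_of_mem_intrinsicInterior hp
    (AffineSubspace.vadd_mem_of_mem_direction (by rwa [direction_affineSpan])
      (subset_affineSpan ℝ C hpC) : u +ᵥ p ∈ affineSpan ℝ C)
  have heq : AffineMap.lineMap p (u +ᵥ p) ε = p := hf hm hpC <| by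
    rw [AffineMap.apply_lineMap, f.map_vadd, LinearMap.mem_ker.mp h0, zero_vadd,
      AffineMap.lineMap_same_apply]
  simpa [AffineMap.lineMap_apply, hε.ne'] using heq

theorem exists_affineMap_leftInvOn {W : Type*} [AddCommGroup W] [Module ℝ W]
    [FiniteDimensional ℝ E] (hC : Convex ℝ C) {f : E →ᵃ[ℝ] W} (hf : InjOn f C) :
    ∃ f' : W →ᵃ[ℝ] E, LeftInvOn f' f C := by
  rcases C.eq_empty_or_nonempty with rfl | ⟨p, hp⟩
  · exact ⟨AffineMap.const ℝ W 0, fun x hx => hx.elim⟩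
  have hinj : LinearMap.ker (f.linear.domRestrict (vectorSpan ℝ C)) = ⊥ :=
    LinearMap.ker_eq_bot.mpr (affineMap_linear_injOn_vectorSpan hC hf).injective
  obtain ⟨g, hg⟩ := LinearMap.exists_leftInverse_of_injective _ hinj
  refine ⟨((vectorSpan ℝ C).subtype ∘ₗ g).toAffineMap + AffineMap.const ℝ W (p - g (f p)),
    fun x hx => ?_⟩
  have hgx : (g (f x) : E) - g (f p) = x - p := by
    rw [← Submodule.coe_sub, ← map_sub, ← affineMap_linear_sub]
    exact congrArg Subtype.val (LinearMap.congr_fun hg ⟨x - p, vsub_mem_vectorSpan ℝ hx hp⟩)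
  simp only [AffineMap.coe_add, Pi.add_apply, LinearMap.coe_toAffineMap, LinearMap.comp_apply,
    Submodule.subtype_apply, AffineMap.const_apply]
  rw [add_sub_left_comm, hgx, add_sub_cancel]

end RelativeInterior

section Polytopes

variable {q : ℕ} {P F : Set (Fin q → ℝ)}

theorem IsPolytope.convex (h : IsPolytope P) : Convex ℝ P := by
  obtain ⟨t, -, rfl⟩ := h
  exact convex_convexHull ℝ _

theorem IsPolytope.nonempty (h : IsPolytope P) : P.Nonempty := by
  obtain ⟨t, ht, rfl⟩ := h
  exact (Finset.coe_nonempty.mpr ht).convexHull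

theorem IsPolytope.isCompact (h : IsPolytope P) : IsCompact P := by
  obtain ⟨t, -, rfl⟩ := h
  exact t.finite_toSet.isCompact_convexHull ℝ

theorem IsPolytope.image {r : ℕ} (h : IsPolytope P) (f : (Fin q → ℝ) →ᵃ[ℝ] (Fin r → ℝ)) :
    IsPolytope (f '' P) := by
  classical
  obtain ⟨t, ht, rfl⟩ := h
  exact ⟨t.image f, ht.image f, by rw [AffineMap.image_convexHull, Finset.coe_image]⟩

theorem IsPolytope.finite_extremePoints (hP : IsPolytope P) : (P.extremePoints ℝ).Finite := by
  obtain ⟨t, -, rfl⟩ := hP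
  exact t.finite_toSet.subset extremePoints_convexHull_subset

theorem IsPolytope.convexHull_extremePoints (hP : IsPolytope P) :
    convexHull ℝ (P.extremePoints ℝ) = P := by
  have h := closure_convexHull_extremePoints hP.isCompact hP.convex
  rwa [(hP.finite_extremePoints.isClosed_convexHull ℝ).closure_eq] at h

theorem notMem_convexHull_of_mem_extremePoints {x : Fin q → ℝ} (hP : Convex ℝ P)
    (hx : x ∈ P.extremePoints ℝ) {T : Set (Fin q → ℝ)} (hT : T ⊆ P) (hxT : x ∉ T) :
    x ∉ convexHull ℝ T := fun h =>
  (hP.mem_extremePoints_iff_mem_sdiff_convexHull_sdiff.mp hx).2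
    (convexHull_mono (subset_sdiff_singleton hT hxT) h)

theorem IsPolytope.isExposed_singleton (hP : IsPolytope P) {x : Fin q → ℝ}
    (hx : x ∈ P.extremePoints ℝ) : IsExposed ℝ P {x} := by
  have hxn : x ∉ convexHull ℝ (P.extremePoints ℝ \ {x}) :=
    notMem_convexHull_of_mem_extremePoints hP.convex hx
      (sdiff_subset.trans extremePoints_subset) (fun h => h.2 rfl)
  obtain ⟨l, u, hl, hu⟩ := geometric_hahn_banach_closed_point (convex_convexHull ℝ _)
    (((hP.finite_extremePoints).subset sdiff_subset).isClosed_convexHull ℝ) hxn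
  let f : (Fin q → ℝ) →ᵃ[ℝ] ℝ :=
    (l : (Fin q → ℝ) →ₗ[ℝ] ℝ).toAffineMap - AffineMap.const ℝ _ (l x)
  have hfx : f x = 0 := by simp [f]
  have hlt : ∀ y ∈ P.extremePoints ℝ, y ≠ x → f y < 0 := fun y hy hne => by
    simpa [f] using (hl y (subset_convexHull ℝ _ ⟨hy, hne⟩)).trans hu
  have hle : ∀ y ∈ P.extremePoints ℝ, f y ≤ 0 := fun y hy => by
    rcases eq_or_ne y x with rfl | hne
    exacts [hfx.le, (hlt y hy hne).le]
  have hzero : {y ∈ P.extremePoints ℝ | f y = 0} = {x} := by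
    ext y
    refine ⟨fun ⟨hy, h0⟩ => by_contra fun hne => (hlt y hy hne).ne h0, ?_⟩
    rintro rfl
    exact ⟨hx, hfx⟩
  have hface := sep_eq_zero_convexHull hle
  rw [hzero, convexHull_singleton, hP.convexHull_extremePoints] at hface
  rw [← hface]
  apply isExposed_sep_eq_zero
  rw [← hP.convexHull_extremePoints]
  exact affineMap_le_of_mem_convexHull hle

theorem IsPolytope.exists_extremePoint_mem (hP : IsPolytope P) (hF : IsExposed ℝ P F)
    (hne : F.Nonempty) : ∃ x ∈ F, x ∈ P.extremePoints ℝ := by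
  obtain ⟨x, hx⟩ := (hF.isCompact hP.isCompact).extremePoints_nonempty hne
  exact ⟨x, hx.1, hF.isExtreme.extremePoints_subset_extremePoints hx⟩

theorem IsPolytope.exists_extremePoint_isMax (hP : IsPolytope P) (f : (Fin q → ℝ) →ᵃ[ℝ] ℝ) :
    ∃ x ∈ P.extremePoints ℝ, ∀ y ∈ P, f y ≤ f x := by
  obtain ⟨a, ha, hmax⟩ := hP.isCompact.exists_isMaxOn hP.nonempty
    f.continuous_of_finiteDimensional.continuousOn
  obtain ⟨x, ⟨-, hx⟩, hxe⟩ := hP.exists_extremePoint_mem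
    (isExposed_sep_eq_zero (f := f - AffineMap.const ℝ _ (f a)) fun y hy => by
      simpa using hmax hy) ⟨a, ha, by simp⟩
  have hfx : f x = f a := by simpa [sub_eq_zero] using hx
  exact ⟨x, hxe, fun y hy => hfx ▸ hmax hy⟩

end Polytopes

section Equivalences

variable {q r : ℕ} {P : Set (Fin q → ℝ)} {R : Set (Fin r → ℝ)}

theorem AffEquiv.exists_inverse (hP : Convex ℝ P) (h : AffEquiv P R) :
    ∃ (f : (Fin q → ℝ) →ᵃ[ℝ] (Fin r → ℝ)) (f' : (Fin r → ℝ) →ᵃ[ℝ] (Fin q → ℝ)),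
      BijOn f P R ∧ InvOn f' f P R := by
  obtain ⟨f, hf⟩ := h
  obtain ⟨f', hf'⟩ := exists_affineMap_leftInvOn hP hf.injOn
  exact ⟨f, f', hf, hf', hf.image_eq ▸ hf'.rightInvOn_image⟩

theorem AffEquiv.symm (hP : Convex ℝ P) (h : AffEquiv P R) : AffEquiv R P := by
  obtain ⟨f, f', hf, hinv⟩ := h.exists_inverse hP
  exact ⟨f', hf.symm hinv.symm⟩

theorem AffEquiv.trans {s : ℕ} {T : Set (Fin s → ℝ)} (h : AffEquiv P R) (h' : AffEquiv R T) :
    AffEquiv P T := by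
  obtain ⟨f, hf⟩ := h
  obtain ⟨g, hg⟩ := h'
  exact ⟨g.comp f, hg.comp hf⟩

theorem AffEquiv.isPolytope (hP : IsPolytope P) (h : AffEquiv P R) : IsPolytope R := by
  obtain ⟨f, hf⟩ := h
  exact hf.image_eq ▸ hP.image f

theorem dim_image_of_injOn (hP : Convex ℝ P) {f : (Fin q → ℝ) →ᵃ[ℝ] (Fin r → ℝ)}
    (hf : InjOn f P) : dim (f '' P) = dim P := by
  rw [dim, dim, ← AffineMap.map_vectorSpan,
    finrank_map_of_injOn (affineMap_linear_injOn_vectorSpan hP hf)]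

theorem AffEquiv.dim_eq (hP : Convex ℝ P) (h : AffEquiv P R) : dim P = dim R := by
  obtain ⟨f, hf⟩ := h
  rw [← hf.image_eq, dim_image_of_injOn hP hf.injOn]

theorem AffEquiv.combEquiv (hP : Convex ℝ P) (h : AffEquiv P R) : CombEquiv P R := by
  obtain ⟨f, f', hf, hinv⟩ := h.exists_inverse hP
  have hleft : ∀ F ⊆ P, f' '' (f '' F) = F := fun F hF => (hinv.1.mono hF).image_image
  have hright : ∀ G ⊆ R, f '' (f' '' G) = G := fun G hG => (hinv.2.mono hG).image_image
  exact ⟨{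
    toFun := fun F => ⟨f '' F.1, hf.image_eq ▸ isExposed_image hinv.1 F.2⟩
    invFun := fun G => ⟨f' '' G.1, (hf.symm hinv.symm).image_eq ▸ isExposed_image hinv.2 G.2⟩
    left_inv := fun F => Subtype.ext (hleft F.1 F.2.subset)
    right_inv := fun G => Subtype.ext (hright G.1 G.2.subset)
    map_rel_iff' := fun {F G} => hf.injOn.image_subset_image_iff F.2.subset G.2.subset }⟩

theorem CombEquiv.symm (h : CombEquiv P R) : CombEquiv R P := h.map OrderIso.symm

theorem CombEquiv.trans {s : ℕ} {T : Set (Fin s → ℝ)} (h : CombEquiv P R) (h' : CombEquiv R T) :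
    CombEquiv P T := by
  obtain ⟨e⟩ := h
  obtain ⟨e'⟩ := h'
  exact ⟨e.trans e'⟩

end Equivalences

section Facets

variable {q : ℕ} {P F : Set (Fin q → ℝ)} {v : Fin q → ℝ}

theorem dim_add_one_eq_dim_insert (hF : IsExposed ℝ P F) (hne : F.Nonempty) (hv : v ∈ P)
    (hvF : v ∉ F) : dim F + 1 = dim (insert v F) := by
  refine le_antisymm ?_ (finrank_vectorSpan_insert_le_set ℝ F v)
  obtain ⟨f, -, rfl⟩ := exists_affineMap_of_isExposed hF
  obtain ⟨x, hx⟩ := hne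
  refine Submodule.finrank_lt_finrank_of_lt <|
    (vectorSpan_mono ℝ (subset_insert v _)).lt_of_ne fun heq => hvF ⟨hv, ?_⟩
  have hvx : v - x ∈ vectorSpan ℝ {x ∈ P | f x = 0} :=
    heq ▸ vsub_mem_vectorSpan ℝ (mem_insert v _) (mem_insert_of_mem v hx)
  have hlin := affineMap_linear_eq_zero_of_mem_vectorSpan (fun y hy => hy.2) hvx
  rwa [affineMap_linear_sub, hx.2, sub_zero] at hlin

theorem exists_affineMap_pos_of_not_vectorSpan_le {T : Set (Fin q → ℝ)} (hvT : v ∈ T)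
    (h : ¬ vectorSpan ℝ P ≤ vectorSpan ℝ T) :
    ∃ g : (Fin q → ℝ) →ᵃ[ℝ] ℝ, (∀ x ∈ T, g x = 0) ∧ ∃ x ∈ P, 0 < g x := by
  obtain ⟨l, hlT, hlP⟩ : ∃ l : (Fin q → ℝ) →ₗ[ℝ] ℝ, vectorSpan ℝ T ≤ LinearMap.ker l ∧
      ¬ vectorSpan ℝ P ≤ LinearMap.ker l := by
    by_contra! hl
    exact h (le_of_forall_le_ker hl)
  rw [vectorSpan_le_ker_iff] at hlT hlP
  obtain ⟨z, hz, hzv⟩ : ∃ z ∈ P, l z ≠ l v := by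
    by_contra! hconst
    exact hlP fun x hx y hy => (hconst x hx).trans (hconst y hy).symm
  rcases hzv.lt_or_gt with hlt | hgt
  · exact ⟨AffineMap.const ℝ _ (l v) - l.toAffineMap,
      fun x hx => by simp [hlT x hx v hvT], z, hz, by simpa using hlt⟩
  · exact ⟨l.toAffineMap - AffineMap.const ℝ _ (l v),
      fun x hx => by simp [hlT x hx v hvT], z, hz, by simpa using hgt⟩

-- `τ` is the largest slope `g x / -f x` over the generating points with `g x > 0`.
theorem IsPolytope.exists_smul_add_le_zero (hP : IsPolytope P) {f g : (Fin q → ℝ) →ᵃ[ℝ] ℝ}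
    (hf : ∀ x ∈ P, f x ≤ 0) (hfg : ∀ x ∈ P, 0 < g x → f x < 0) (hg : ∃ x ∈ P, 0 < g x) :
    ∃ τ : ℝ, 0 < τ ∧ (∀ x ∈ P, (τ • f + g) x ≤ 0) ∧ ∃ y ∈ P, 0 < g y ∧ (τ • f + g) y = 0 := by
  obtain ⟨t, -, rfl⟩ := hP
  have htP : ∀ x ∈ t, x ∈ convexHull ℝ (t : Set (Fin q → ℝ)) :=
    fun x hx => subset_convexHull ℝ _ hx
  have hne : (t.filter fun x => 0 < g x).Nonempty := by
    obtain ⟨x, hx, hgx⟩ := hg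
    by_contra hempty
    rw [Finset.not_nonempty_iff_eq_empty, Finset.filter_eq_empty_iff] at hempty
    exact (affineMap_le_of_mem_convexHull (fun y hy => not_lt.mp (hempty hy)) x hx).not_gt hgx
  obtain ⟨y, hy, hmax⟩ := Finset.exists_max_image _ (fun x => g x / -f x) hne
  obtain ⟨hyt, hgy⟩ := Finset.mem_filter.mp hy
  have hfy := hfg y (htP y hyt) hgy
  have hτ : 0 < g y / -f y := div_pos hgy (neg_pos.mpr hfy)
  refine ⟨g y / -f y, hτ, affineMap_le_of_mem_convexHull fun x hx => ?_, y, htP y hyt, hgy, ?_⟩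
  · simp only [AffineMap.coe_add, AffineMap.coe_smul, Pi.add_apply, Pi.smul_apply, smul_eq_mul]
    by_cases hgx : 0 < g x
    · have hle := hmax x (Finset.mem_filter.mpr ⟨hx, hgx⟩)
      rw [div_le_iff₀ (neg_pos.mpr (hfg x (htP x hx) hgx))] at hle
      linarith
    · have := mul_nonpos_of_nonneg_of_nonpos hτ.le (hf x (htP x hx))
      linarith
  · simp only [AffineMap.coe_add, AffineMap.coe_smul, Pi.add_apply, Pi.smul_apply, smul_eq_mul]
    field_simp [hfy.ne]
    ring

theorem IsPolytope.exists_isExposed_dim_lt (hP : IsPolytope P) (hv : v ∈ P)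
    (hF : IsExposed ℝ P F) (hvF : v ∉ F) (hdim : dim (insert v F) < dim P) :
    ∃ G, IsExposed ℝ P G ∧ F ⊆ G ∧ v ∉ G ∧ dim (insert v F) < dim (insert v G) := by
  obtain ⟨f, hf, rfl⟩ := exists_affineMap_of_isExposed hF
  set F := {x ∈ P | f x = 0}
  have hspan : ¬ vectorSpan ℝ P ≤ vectorSpan ℝ (insert v F) :=
    fun hle => hdim.not_ge (Submodule.finrank_mono hle)
  obtain ⟨g, hgF, hgP⟩ :=
    exists_affineMap_pos_of_not_vectorSpan_le (mem_insert v F) hspan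
  have hgv : g v = 0 := hgF v (mem_insert v F)
  obtain ⟨τ, hτ, hle, y, hy, hgy, hτy⟩ := hP.exists_smul_add_le_zero hf
    (fun x hx hgx => (hf x hx).lt_of_ne fun h0 => hgx.ne' (hgF x (mem_insert_of_mem v ⟨hx, h0⟩)))
    hgP
  have hFG : F ⊆ {x ∈ P | (τ • f + g) x = 0} := fun x hx =>
    ⟨hx.1, by simp [hx.2, hgF x (mem_insert_of_mem v hx)]⟩
  refine ⟨_, isExposed_sep_eq_zero hle, hFG, fun hvG => ?_, ?_⟩
  · have hfv : τ * f v = 0 := by simpa [hgv] using hvG.2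
    exact hvF ⟨hv, (mul_eq_zero.mp hfv).resolve_left hτ.ne'⟩
  · refine Submodule.finrank_lt_finrank_of_lt <|
      (vectorSpan_mono ℝ (insert_subset_insert hFG)).lt_of_ne fun heq => hgy.ne' ?_
    have hyv : y - v ∈ vectorSpan ℝ (insert v F) :=
      heq ▸ vsub_mem_vectorSpan ℝ (mem_insert_of_mem v ⟨hy, hτy⟩) (mem_insert v _)
    have hlin := affineMap_linear_eq_zero_of_mem_vectorSpan hgF hyv
    rwa [affineMap_linear_sub, hgv, sub_zero] at hlin

theorem IsPolytope.exists_isFacet_superset (hP : IsPolytope P) (hd : 0 < dim P) (hv : v ∈ P)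
    (hF : IsExposed ℝ P F) (hvF : v ∉ F) : ∃ G, IsFacet P G ∧ F ⊆ G ∧ v ∉ G := by
  induction hk : dim P - dim (insert v F) using Nat.strong_induction_on generalizing F with
  | _ k ih =>
  have hle : dim (insert v F) ≤ dim P :=
    Submodule.finrank_mono (vectorSpan_mono ℝ (insert_subset hv hF.subset))
  rcases hle.lt_or_eq with hlt | heq
  · obtain ⟨G, hG, hFG, hvG, hdim⟩ := hP.exists_isExposed_dim_lt hv hF hvF hlt
    obtain ⟨H, hH, hGH, hvH⟩ := ih _ (by omega) hG hvG rfl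
    exact ⟨H, hH, hFG.trans hGH, hvH⟩
  · have hne : F.Nonempty := by
      rw [nonempty_iff_ne_empty]
      rintro rfl
      rw [← heq, dim, insert_empty_eq, vectorSpan_singleton, finrank_bot] at hd
      exact hd.false
    exact ⟨F, ⟨hF, hne, by rw [dim_add_one_eq_dim_insert hF hne hv hvF, heq]⟩, Subset.rfl, hvF⟩

theorem IsFacet.vectorSpan_eq (hF : IsFacet P F) {f : (Fin q → ℝ) →ᵃ[ℝ] ℝ}
    (hf : ∀ x ∈ F, f x = 0) {x : Fin q → ℝ} (hx : x ∈ P) (hfx : f x ≠ 0) :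
    vectorSpan ℝ F = vectorSpan ℝ P ⊓ LinearMap.ker f.linear := by
  obtain ⟨hE, ⟨z, hz⟩, hd⟩ := hF
  have hle : vectorSpan ℝ F ≤ vectorSpan ℝ P ⊓ LinearMap.ker f.linear := fun u hu =>
    ⟨vectorSpan_mono ℝ hE.subset hu, affineMap_linear_eq_zero_of_mem_vectorSpan hf hu⟩
  have hlt : vectorSpan ℝ P ⊓ LinearMap.ker f.linear < vectorSpan ℝ P := by
    refine inf_le_left.lt_of_ne fun heq => hfx ?_
    have hlin := (inf_eq_left.mp heq) (vsub_mem_vectorSpan ℝ hx (hE.subset hz))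
    rwa [LinearMap.mem_ker, vsub_eq_sub, affineMap_linear_sub, hf z hz, sub_zero] at hlin
  refine Submodule.eq_of_le_of_finrank_le hle ?_
  have := Submodule.finrank_lt_finrank_of_lt hlt
  unfold dim at hd
  omega

theorem IsFacet.mul_eq_mul (hF : IsFacet P F) {f g : (Fin q → ℝ) →ᵃ[ℝ] ℝ}
    (hf : ∀ x ∈ F, f x = 0) (hg : ∀ x ∈ F, g x = 0) {x y : Fin q → ℝ} (hx : x ∈ P) (hy : y ∈ P) :
    f x * g y = f y * g x := by
  wlog hfx : f x ≠ 0 generalizing x y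
  · rcases eq_or_ne (f y) 0 with hfy | hfy
    · rw [not_not.mp hfx, hfy, zero_mul, zero_mul]
    · exact (this hy hx hfy).symm
  obtain ⟨z, hz⟩ := hF.2.1
  have hzP := hF.1.subset hz
  have hmem : f x • (y - z) - f y • (x - z) ∈ vectorSpan ℝ F := by
    rw [hF.vectorSpan_eq hf hx hfx]
    refine ⟨sub_mem (Submodule.smul_mem _ _ (vsub_mem_vectorSpan ℝ hy hzP))
      (Submodule.smul_mem _ _ (vsub_mem_vectorSpan ℝ hx hzP)), ?_⟩
    rw [SetLike.mem_coe, LinearMap.mem_ker, map_sub, map_smul, map_smul, affineMap_linear_sub,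
      affineMap_linear_sub, hf z hz, smul_eq_mul, smul_eq_mul]
    ring
  have hlin := affineMap_linear_eq_zero_of_mem_vectorSpan hg hmem
  rw [map_sub, map_smul, map_smul, affineMap_linear_sub, affineMap_linear_sub, hg z hz,
    smul_eq_mul, smul_eq_mul] at hlin
  linarith

end Facets

section SplitHulls

/-- `P` is the convex hull of the union of a simplex with vertices `v k` and a polytope `C` whose
affine hulls meet only in `p`, where `p` is a relative interior point of `C` and has barycentric
coordinates `lam` in the simplex. The weights may vanish, so that `p` may lie on the boundary of the
simplex; since they are all less than one, `p` is not a vertex of it. Every meek polytope and every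
polytope `pyr^i(Σ_j ⊕ Q)` has this form, the vanishing weights belonging to the apices. -/
structure SplitHull {ι : Type} [Fintype ι] {q : ℕ} (v : ι → Fin q → ℝ) (lam : ι → ℝ)
    (p : Fin q → ℝ) (C P : Set (Fin q → ℝ)) : Prop where
  nonneg : ∀ k, 0 ≤ lam k
  lt_one : ∀ k, lam k < 1
  sum_eq_one : ∑ k, lam k = 1
  center_eq : p = ∑ k, lam k • v k
  isPolytope_base : IsPolytope C
  center_mem : p ∈ intrinsicInterior ℝ C
  affineIndependent : AffineIndependent ℝ v
  disjoint : Disjoint (vectorSpan ℝ (range v)) (vectorSpan ℝ C)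
  hull : P = convexHull ℝ (range v ∪ C)

namespace SplitHull

variable {ι : Type} [Fintype ι] {q : ℕ} {v : ι → Fin q → ℝ} {lam : ι → ℝ} {p : Fin q → ℝ}
  {C P F : Set (Fin q → ℝ)}

theorem point_mem (h : SplitHull v lam p C P) (k : ι) : v k ∈ P := by
  rw [h.hull]
  exact subset_convexHull ℝ _ (Or.inl ⟨k, rfl⟩)

theorem base_subset (h : SplitHull v lam p C P) : C ⊆ P := by
  rw [h.hull]
  exact subset_union_right.trans (subset_convexHull ℝ _)

theorem isPolytope (h : SplitHull v lam p C P) : IsPolytope P := by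
  classical
  obtain ⟨t, ht, hC⟩ := h.isPolytope_base
  refine ⟨Finset.univ.image v ∪ t, ht.mono Finset.subset_union_right, ?_⟩
  rw [h.hull, hC, convexHull_convexHull_union_right, Finset.coe_union, Finset.coe_image,
    Finset.coe_univ, image_univ]

theorem center_mem_base (h : SplitHull v lam p C P) : p ∈ C := intrinsicInterior_subset h.center_mem

theorem center_mem_affineSpan (h : SplitHull v lam p C P) : p ∈ affineSpan ℝ (range v) :=
  h.center_eq ▸ sum_smul_mem_affineSpan h.sum_eq_one

theorem point_sub_center_mem (h : SplitHull v lam p C P) (k : ι) :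
    v k - p ∈ vectorSpan ℝ (range v) := by
  rw [← direction_affineSpan]
  exact AffineSubspace.vsub_mem_direction (mem_affineSpan ℝ ⟨k, rfl⟩) h.center_mem_affineSpan

theorem apply_center (h : SplitHull v lam p C P) {W : Type*} [AddCommGroup W] [Module ℝ W]
    (f : (Fin q → ℝ) →ᵃ[ℝ] W) : f p = ∑ k, lam k • f (v k) := by
  rw [h.center_eq, affineMap_sum_smul f v h.sum_eq_one]

theorem exists_extension (h : SplitHull v lam p C P) {W : Type*} [AddCommGroup W] [Module ℝ W]
    (α : ι → W) (g : (Fin q → ℝ) →ᵃ[ℝ] W) (hg : g p = ∑ k, lam k • α k) :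
    ∃ f : (Fin q → ℝ) →ᵃ[ℝ] W, (∀ k, f (v k) = α k) ∧ EqOn f g C := by
  obtain ⟨f₀, hf₀⟩ := exists_affineMap_apply_eq h.affineIndependent α
  have hp : f₀ p = g p := by simp only [h.apply_center f₀, hf₀, hg]
  obtain ⟨f, hfv, hfC⟩ := exists_affineMap_eqOn_eqOn h.disjoint h.center_mem_affineSpan
    (subset_affineSpan ℝ C h.center_mem_base) hp
  exact ⟨f, fun k => (hfv ⟨k, rfl⟩).trans (hf₀ k), hfC⟩

theorem le_of_forall_le (h : SplitHull v lam p C P) {f : (Fin q → ℝ) →ᵃ[ℝ] ℝ} {c : ℝ}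
    (hv : ∀ k, f (v k) ≤ c) (hC : ∀ x ∈ C, f x ≤ c) : ∀ x ∈ P, f x ≤ c := by
  rw [h.hull]
  apply affineMap_le_of_mem_convexHull
  rintro x (⟨k, rfl⟩ | hx)
  exacts [hv k, hC x hx]

theorem eqOn_of_eqOn (h : SplitHull v lam p C P) {W : Type*} [AddCommGroup W] [Module ℝ W]
    {f g : (Fin q → ℝ) →ᵃ[ℝ] W} (hv : ∀ k, f (v k) = g (v k)) (hC : EqOn f g C) : EqOn f g P := by
  have hunion : EqOn f g (range v ∪ C) := by
    rintro x (⟨k, rfl⟩ | hx)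
    exacts [hv k, hC hx]
  rw [h.hull]
  exact (affineMap_eqOn_affineSpan hunion).mono (convexHull_subset_affineSpan _)

theorem sep_eq_zero (h : SplitHull v lam p C P) {f : (Fin q → ℝ) →ᵃ[ℝ] ℝ}
    (hf : ∀ x ∈ P, f x ≤ 0) :
    {x ∈ P | f x = 0} = convexHull ℝ {x ∈ range v ∪ C | f x = 0} := by
  rw [h.hull] at hf ⊢
  exact sep_eq_zero_convexHull fun x hx => hf x (subset_convexHull ℝ _ hx)

theorem vectorSpan_eq (h : SplitHull v lam p C P) :
    vectorSpan ℝ P = vectorSpan ℝ (range v) ⊔ vectorSpan ℝ C := by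
  apply le_antisymm
  · have hsub : ∀ x ∈ range v ∪ C, x - p ∈ vectorSpan ℝ (range v) ⊔ vectorSpan ℝ C := by
      rintro x (⟨k, rfl⟩ | hx)
      · exact Submodule.mem_sup_left (h.point_sub_center_mem k)
      · exact Submodule.mem_sup_right (vsub_mem_vectorSpan ℝ hx h.center_mem_base)
    rw [h.hull, vectorSpan_convexHull, vectorSpan_le_iff]
    intro x hx y hy
    rw [← sub_sub_sub_cancel_right x y p]
    exact sub_mem (hsub x hx) (hsub y hy)
  · exact sup_le (vectorSpan_mono ℝ (range_subset_iff.mpr h.point_mem))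
      (vectorSpan_mono ℝ h.base_subset)

theorem dim_eq (h : SplitHull v lam p C P) {m : ℕ} (hm : Fintype.card ι = m + 1) :
    dim P = dim C + m := by
  have hsup := Submodule.finrank_sup_add_finrank_inf_eq (vectorSpan ℝ (range v)) (vectorSpan ℝ C)
  rw [h.disjoint.eq_bot, finrank_bot, h.affineIndependent.finrank_vectorSpan hm] at hsup
  rw [dim, dim, h.vectorSpan_eq]
  omega

-- The exposing function is the barycentric coordinate of `v k`, which has the value `lam k < 1`
-- on `C`.
theorem isExposed_point (h : SplitHull v lam p C P) (k : ι) : IsExposed ℝ P {v k} := by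
  classical
  obtain ⟨f, hf, hfC⟩ := h.exists_extension (fun l => (Pi.single k 1 : ι → ℝ) l - 1)
    (AffineMap.const ℝ _ (lam k - 1)) (by
      simp [mul_sub, Finset.sum_sub_distrib, h.sum_eq_one, Pi.single_apply])
  have hv : ∀ l, l ≠ k → f (v l) < 0 := fun l hl => by simp [hf, hl]
  have hk : f (v k) = 0 := by simp [hf]
  have hC : ∀ x ∈ C, f x < 0 := fun x hx => by
    rw [hfC hx, AffineMap.const_apply, sub_neg]
    exact h.lt_one k
  have hle : ∀ x ∈ P, f x ≤ 0 := by
    refine h.le_of_forall_le (fun l => ?_) fun x hx => (hC x hx).le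
    rcases eq_or_ne l k with rfl | hl
    exacts [hk.le, (hv l hl).le]
  have hzero : {x ∈ range v ∪ C | f x = 0} = {v k} := by
    ext x
    rw [mem_ofPred_eq, mem_singleton_iff]
    constructor
    · rintro ⟨⟨l, rfl⟩ | hx, h0⟩
      · by_contra hne
        exact (hv l fun hl => hne (hl ▸ rfl)).ne h0
      · exact absurd h0 (hC x hx).ne
    · rintro rfl
      exact ⟨Or.inl ⟨k, rfl⟩, hk⟩
  have hface := isExposed_sep_eq_zero hle
  rwa [h.sep_eq_zero hle, hzero, convexHull_singleton] at hface

theorem eq_zero_on_base (h : SplitHull v lam p C P) {f : (Fin q → ℝ) →ᵃ[ℝ] ℝ}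
    (hf : ∀ x ∈ P, f x ≤ 0) (hv : ∀ k, 0 < lam k → f (v k) = 0) : ∀ x ∈ C, f x = 0 := by
  have hp : f p = 0 := by
    rw [h.apply_center f]
    refine Finset.sum_eq_zero fun k _ => ?_
    rcases (h.nonneg k).eq_or_lt with hk | hk
    · rw [← hk, zero_smul]
    · rw [hv k hk, smul_zero]
  intro x hx
  rw [eq_of_le_of_mem_intrinsicInterior h.center_mem
    (fun y hy => hp ▸ hf y (h.base_subset hy)) x hx, hp]

theorem eq_zero_at_point (h : SplitHull v lam p C P) {f : (Fin q → ℝ) →ᵃ[ℝ] ℝ}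
    (hf : ∀ x ∈ P, f x ≤ 0) (hp : f p = 0) {k : ι} (hk : 0 < lam k) : f (v k) = 0 := by
  rw [h.apply_center f] at hp
  have hterm := (Finset.sum_eq_zero_iff_of_nonpos fun l _ =>
    mul_nonpos_of_nonneg_of_nonpos (h.nonneg l) (hf _ (h.point_mem l))).mp hp k (Finset.mem_univ k)
  exact (mul_eq_zero.mp hterm).resolve_left hk.ne'

theorem exists_point_notMem_of_isFacet (h : SplitHull v lam p C P) (hF : IsFacet P F) :
    ∃ k, v k ∉ F := by
  obtain ⟨f, hf, rfl⟩ := exists_affineMap_of_isExposed hF.1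
  by_contra! hall
  have hzero : EqOn f (AffineMap.const ℝ (Fin q → ℝ) (0 : ℝ)) P :=
    h.eqOn_of_eqOn (fun k => (hall k).2) (h.eq_zero_on_base hf fun k _ => (hall k).2)
  have hFP : {x ∈ P | f x = 0} = P := sep_eq_self_iff_mem_true.mpr hzero
  have hdim := hF.2.2
  rw [hFP] at hdim
  omega

-- If the facet misses `v a`, then the function that agrees with a multiple of `f` on `C`, is `1` at
-- `v a` and `0` at the other points also vanishes on the facet, hence is a multiple of `f` on `P`.
theorem eq_zero_of_isFacet_of_ne (h : SplitHull v lam p C P) {f : (Fin q → ℝ) →ᵃ[ℝ] ℝ}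
    (hf : ∀ x ∈ P, f x ≤ 0) (hF : IsFacet P {x ∈ P | f x = 0}) {a b : ι} (ha : f (v a) ≠ 0)
    (hab : b ≠ a) : f (v b) = 0 := by
  classical
  obtain ⟨τ, hτ⟩ : ∃ τ : ℝ, τ * f p = lam a := by
    rcases eq_or_ne (f p) 0 with hp | hp
    · refine ⟨0, ?_⟩
      rw [zero_mul]
      by_contra hne
      exact ha (h.eq_zero_at_point hf hp ((h.nonneg a).lt_of_ne hne))
    · exact ⟨lam a / f p, div_mul_cancel₀ _ hp⟩
  obtain ⟨g, hg, hgC⟩ := h.exists_extension (Pi.single a 1) (τ • f) (by simp [Pi.single_apply, hτ])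
  have hgF : ∀ x ∈ {x ∈ P | f x = 0}, g x = 0 := by
    have hunion : EqOn g (AffineMap.const ℝ _ 0) {x ∈ range v ∪ C | f x = 0} := by
      rintro y ⟨⟨k, rfl⟩ | hy, h0⟩
      · have hka : k ≠ a := fun hk => ha (hk ▸ h0)
        simp [hg, hka]
      · simp [hgC hy, h0]
    rw [h.sep_eq_zero hf]
    exact (affineMap_eqOn_affineSpan hunion).mono (convexHull_subset_affineSpan _)
  have hmul := hF.mul_eq_mul (fun x hx => hx.2) hgF (h.point_mem a) (h.point_mem b)
  rw [hg, hg, Pi.single_eq_same, Pi.single_eq_of_ne hab, mul_zero, mul_one] at hmul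
  exact hmul.symm

theorem existsUnique_point_notMem_of_isFacet (h : SplitHull v lam p C P) (hF : IsFacet P F) :
    ∃! k, v k ∉ F := by
  obtain ⟨a, ha⟩ := h.exists_point_notMem_of_isFacet hF
  refine ⟨a, ha, fun b hb => ?_⟩
  obtain ⟨f, hf, rfl⟩ := exists_affineMap_of_isExposed hF.1
  by_contra hab
  exact hb ⟨h.point_mem b,
    h.eq_zero_of_isFacet_of_ne hf hF (fun h0 => ha ⟨h.point_mem a, h0⟩) hab⟩

variable {s : Finset (Fin q → ℝ)}

theorem isSpecialSimplex (h : SplitHull v lam p C P) (hs : (s : Set (Fin q → ℝ)) = range v) {m : ℕ}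
    (hm : Fintype.card ι = m + 1) : IsSpecialSimplex m P s := by
  refine ⟨?_, ?_, ?_, fun F hF => ?_⟩
  · rw [← Set.ncard_coe_finset, hs, ← Set.image_univ,
      Set.ncard_image_of_injective _ h.affineIndependent.injective, Set.ncard_univ,
      Nat.card_eq_fintype_card, hm]
  · rw [hs]
    rintro _ ⟨k, rfl⟩
    exact exposedPoints_subset_extremePoints
      (mem_exposedPoints_iff_exposed_singleton.mpr (h.isExposed_point k))
  · have hrange := h.affineIndependent.range
    rwa [← hs] at hrange
  · obtain ⟨k, hk, huniq⟩ := h.existsUnique_point_notMem_of_isFacet hF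
    simp only [← Finset.mem_coe, hs]
    refine ⟨v k, ⟨⟨k, rfl⟩, hk⟩, ?_⟩
    rintro _ ⟨⟨l, rfl⟩, hl⟩
    rw [huniq l hl]

theorem restComplexSupport_subset (h : SplitHull v lam p C P)
    (hs : (s : Set (Fin q → ℝ)) = range v) : restComplexSupport P s ⊆ C := by
  rintro x ⟨F, ⟨hF, hdisj⟩, hx⟩
  obtain ⟨f, hf, rfl⟩ := exists_affineMap_of_isExposed hF
  rw [h.sep_eq_zero hf] at hx
  refine convexHull_min ?_ h.isPolytope_base.convex hx
  rintro y ⟨⟨k, rfl⟩ | hy, h0⟩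
  · exact absurd (hs ▸ mem_range_self k) (disjoint_left.mp hdisj ⟨h.point_mem k, h0⟩)
  · exact hy

-- The face of `C` where `g` is maximal is a face of `P` as well: extend `g` to the points `v k` by
-- the constant value `g p`, which is smaller than the maximum.
theorem exists_mem_restComplexSupport_isMax (h : SplitHull v lam p C P)
    (hs : (s : Set (Fin q → ℝ)) = range v) {g : (Fin q → ℝ) →ᵃ[ℝ] ℝ} (hg : ∃ x ∈ C, g x ≠ g p) :
    ∃ x ∈ restComplexSupport P s, ∀ y ∈ C, g y ≤ g x := by
  obtain ⟨z, hz, hmax⟩ := h.isPolytope_base.exists_extremePoint_isMax g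
  have hzC : z ∈ C := extremePoints_subset hz
  have hlt : g p < g z := by
    refine (hmax p h.center_mem_base).lt_of_ne fun heq => ?_
    obtain ⟨x, hx, hne⟩ := hg
    exact hne (eq_of_le_of_mem_intrinsicInterior h.center_mem (fun y hy => heq ▸ hmax y hy) x hx)
  obtain ⟨f, hf, hfC⟩ := h.exists_extension (fun _ => g p - g z) (g - AffineMap.const ℝ _ (g z)) (by
    simp [← Finset.sum_mul, h.sum_eq_one])
  have hfC' : ∀ x ∈ C, f x = g x - g z := fun x hx => by simp [hfC hx]
  have hle : ∀ x ∈ P, f x ≤ 0 := h.le_of_forall_le (fun k => by rw [hf]; linarith) fun x hx => by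
    rw [hfC' x hx]
    linarith [hmax x hx]
  refine ⟨z, ⟨_, ⟨isExposed_sep_eq_zero hle, ?_⟩,
    h.base_subset hzC, by rw [hfC' z hzC, sub_self]⟩, hmax⟩
  rw [hs, disjoint_left]
  rintro _ ⟨-, hx⟩ ⟨k, rfl⟩
  rw [hf] at hx
  linarith

theorem vectorSpan_restComplexSupport (h : SplitHull v lam p C P)
    (hs : (s : Set (Fin q → ℝ)) = range v) :
    vectorSpan ℝ (restComplexSupport P s) = vectorSpan ℝ C := by
  refine (vectorSpan_mono ℝ (h.restComplexSupport_subset hs)).antisymm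
    (le_of_forall_le_ker fun l hl => ?_)
  rw [vectorSpan_le_ker_iff] at hl ⊢
  suffices hconst : ∀ z ∈ C, l z = l p from
    fun x hx y hy => (hconst x hx).trans (hconst y hy).symm
  by_contra! hne
  obtain ⟨z, hz, hzp⟩ := hne
  obtain ⟨a, ha, hmax⟩ := h.exists_mem_restComplexSupport_isMax hs (g := l.toAffineMap)
    ⟨z, hz, hzp⟩
  obtain ⟨b, hb, hmin⟩ := h.exists_mem_restComplexSupport_isMax hs (g := (-l).toAffineMap)
    ⟨z, hz, by simpa using hzp⟩
  simp only [LinearMap.coe_toAffineMap, LinearMap.neg_apply, neg_le_neg_iff] at hmax hmin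
  have hab := hl a ha b hb
  have hp := h.center_mem_base
  exact hzp (by linarith [hmax z hz, hmin z hz, hmax p hp, hmin p hp])

theorem affEquiv_of_isBasisPolytope (h : SplitHull v lam p C P)
    (hs : (s : Set (Fin q → ℝ)) = range v) {d : ℕ} {B : Set (Fin d → ℝ)}
    (hB : IsBasisPolytope P s B) : AffEquiv C B := by
  obtain ⟨π, -, hker, rfl⟩ := hB
  rw [hs] at hker
  have hv : ∀ k, π p = π (v k) := fun k => by
    have hk := h.point_sub_center_mem k
    rwa [← hker, LinearMap.mem_ker, map_sub, sub_eq_zero, eq_comm] at hk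
  refine ⟨π.toAffineMap, fun x hx => mem_image_of_mem π (h.base_subset hx), fun x hx y hy hxy => ?_,
    ?_⟩
  · have hxyv : x - y ∈ vectorSpan ℝ (range v) := by
      rwa [← hker, LinearMap.mem_ker, map_sub, sub_eq_zero]
    exact sub_eq_zero.mp (Submodule.disjoint_def.mp h.disjoint _ hxyv (vsub_mem_vectorSpan ℝ hx hy))
  · rw [h.hull]
    refine image_subset_iff.mpr
      (convexHull_min ?_ ((h.isPolytope_base.convex.linear_image π).linear_preimage π))
    rintro x (⟨k, rfl⟩ | hx)
    exacts [⟨p, h.center_mem_base, hv k⟩, ⟨x, hx, rfl⟩]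

end SplitHull

theorem exists_isBasisPolytope {q : ℕ} (P : Set (Fin q → ℝ)) (s : Finset (Fin q → ℝ)) :
    ∃ (d : ℕ) (B : Set (Fin d → ℝ)), IsBasisPolytope P s B := by
  let U := vectorSpan ℝ (s : Set (Fin q → ℝ))
  let e := (Module.finBasis ℝ ((Fin q → ℝ) ⧸ U)).equivFun
  refine ⟨_, _, e.toLinearMap ∘ₗ U.mkQ, e.surjective.comp U.mkQ_surjective, ?_, rfl⟩
  rw [LinearMap.ker_comp, LinearEquiv.ker, Submodule.comap_bot, Submodule.ker_mkQ]

namespace SplitHull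

variable {ι : Type} [Fintype ι] {q : ℕ} {v : ι → Fin q → ℝ} {lam : ι → ℝ} {p : Fin q → ℝ}
  {C P : Set (Fin q → ℝ)}

theorem isMeek (h : SplitHull v lam p C P) {s : Finset (Fin q → ℝ)}
    (hs : (s : Set (Fin q → ℝ)) = range v) : IsMeek P s := by
  obtain ⟨d, B, hB⟩ := exists_isBasisPolytope P s
  refine ⟨d, B, hB, ?_⟩
  rw [← (h.affEquiv_of_isBasisPolytope hs hB).dim_eq h.isPolytope_base.convex, dim, dim,
    h.vectorSpan_restComplexSupport hs]

theorem image {r : ℕ} (h : SplitHull v lam p C P) {f : (Fin q → ℝ) →ᵃ[ℝ] (Fin r → ℝ)}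
    (hf : InjOn f P) : SplitHull (f ∘ v) lam (f p) (f '' C) (f '' P) where
  nonneg := h.nonneg
  lt_one := h.lt_one
  sum_eq_one := h.sum_eq_one
  center_eq := h.apply_center f
  isPolytope_base := h.isPolytope_base.image f
  center_mem := map_mem_intrinsicInterior_image h.isPolytope_base.convex h.center_mem f
  affineIndependent := by
    obtain ⟨f', hf'⟩ := exists_affineMap_leftInvOn h.isPolytope.convex hf
    refine AffineIndependent.of_comp f' ?_
    have hcomp : f' ∘ f ∘ v = v := funext fun k => hf' (h.point_mem k)
    rw [hcomp]
    exact h.affineIndependent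
  disjoint := by
    rw [range_comp, ← AffineMap.map_vectorSpan, ← AffineMap.map_vectorSpan]
    rw [Submodule.disjoint_def]
    rintro _ ⟨x, hx, rfl⟩ ⟨y, hy, hxy⟩
    have hyx : y = x := affineMap_linear_injOn_vectorSpan h.isPolytope.convex hf
      (vectorSpan_mono ℝ h.base_subset hy)
      (vectorSpan_mono ℝ (range_subset_iff.mpr h.point_mem) hx) hxy
    rw [Submodule.disjoint_def.mp h.disjoint x hx (hyx ▸ hy), map_zero]
  hull := by rw [h.hull, AffineMap.image_convexHull, image_union, range_comp]

theorem reindex {κ : Type} [Fintype κ] (h : SplitHull v lam p C P) (e : κ ≃ ι) :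
    SplitHull (v ∘ e) (lam ∘ e) p C P where
  nonneg k := h.nonneg (e k)
  lt_one k := h.lt_one (e k)
  sum_eq_one := by rw [← h.sum_eq_one]; exact e.sum_comp lam
  center_eq := by rw [h.center_eq]; exact (e.sum_comp fun k => lam k • v k).symm
  isPolytope_base := h.isPolytope_base
  center_mem := h.center_mem
  affineIndependent := h.affineIndependent.comp_embedding e.toEmbedding
  disjoint := by rw [e.surjective.range_comp]; exact h.disjoint
  hull := by rw [h.hull, e.surjective.range_comp]

theorem affEquiv {r : ℕ} {w : ι → Fin r → ℝ} {p' : Fin r → ℝ} {D R : Set (Fin r → ℝ)}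
    (h : SplitHull v lam p C P) (h' : SplitHull w lam p' D R)
    {φ : (Fin q → ℝ) →ᵃ[ℝ] (Fin r → ℝ)} (hφ : BijOn φ C D) (hp : φ p = p') : AffEquiv P R := by
  obtain ⟨ψ, hψ⟩ := exists_affineMap_leftInvOn h.isPolytope_base.convex hφ.injOn
  obtain ⟨f, hf, hfC⟩ := h.exists_extension w φ (by rw [hp, h'.center_eq])
  obtain ⟨f', hf', hfD⟩ := h'.exists_extension v ψ (by
    rw [← hp, hψ h.center_mem_base, h.center_eq])
  have hleft : LeftInvOn f' f P := by
    refine h.eqOn_of_eqOn (f := f'.comp f) (g := AffineMap.id ℝ _) (fun k => ?_) fun x hx => ?_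
    · simp [hf, hf']
    · simp [hfC hx, hfD (hφ.mapsTo hx), hψ hx]
  have himage : f '' P = R := by
    rw [h.hull, AffineMap.image_convexHull, image_union, ← range_comp, hfC.image_eq, hφ.image_eq,
      h'.hull, show ⇑f ∘ v = w from funext hf]
  exact ⟨f, himage ▸ hleft.injOn.bijOn_image⟩

end SplitHull

end SplitHulls

section MeekSimplices

theorem exists_mem_affineSpan_mem_affineSpan {V : Type*} [AddCommGroup V] [Module ℝ V] {A B : Set V}
    {a b : V} (ha : a ∈ A) (hb : b ∈ B) (hab : a - b ∈ vectorSpan ℝ A ⊔ vectorSpan ℝ B) :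
    ∃ p, p ∈ affineSpan ℝ A ∧ p ∈ affineSpan ℝ B := by
  obtain ⟨u, hu, w, hw, huw⟩ := Submodule.mem_sup.mp hab
  rw [← direction_affineSpan] at hu hw
  refine ⟨w +ᵥ b, ?_, AffineSubspace.vadd_mem_of_mem_direction hw (mem_affineSpan ℝ hb)⟩
  have hp : w +ᵥ b = -u +ᵥ a := by
    rw [vadd_eq_add, vadd_eq_add, ← sub_add_cancel a b, ← huw]
    abel
  rw [hp]
  exact AffineSubspace.vadd_mem_of_mem_direction (neg_mem hu) (mem_affineSpan ℝ ha)

theorem sum_smul_eq_of_one_le {V ι : Type*} [AddCommGroup V] [Module ℝ V] [Fintype ι] (v : ι → V)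
    {w : ι → ℝ} (hw : ∀ k, 0 ≤ w k) (hsum : ∑ k, w k = 1) {k : ι} (hk : 1 ≤ w k) :
    ∑ l, w l • v l = v k := by
  classical
  have hsplit := Finset.add_sum_erase Finset.univ w (Finset.mem_univ k)
  have hrest_nonneg := Finset.sum_nonneg (s := Finset.univ.erase k) fun l _ => hw l
  have hrest : ∑ l ∈ Finset.univ.erase k, w l = 0 := by linarith
  have hne : ∀ l, l ≠ k → w l = 0 := fun l hl =>
    (Finset.sum_eq_zero_iff_of_nonneg fun l _ => hw l).mp hrest l
      (Finset.mem_erase.mpr ⟨hl, Finset.mem_univ l⟩)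
  have hwk : w k = 1 := by linarith
  rw [Fintype.sum_eq_single k fun l hl => by rw [hne l hl, zero_smul], hwk, one_smul]

/-- The vertices of `P` outside the simplex with vertex set `s`. -/
def remainingVertices {q : ℕ} (P : Set (Fin q → ℝ)) (s : Finset (Fin q → ℝ)) : Set (Fin q → ℝ) :=
  P.extremePoints ℝ \ s

namespace IsSpecialSimplex

variable {q m : ℕ} {P : Set (Fin q → ℝ)} {s : Finset (Fin q → ℝ)}

theorem eq_zero_of_forall_mem (hs : IsSpecialSimplex m P s) (hP : IsPolytope P) (hd : 0 < dim P)
    {f : (Fin q → ℝ) →ᵃ[ℝ] ℝ} (hf : ∀ x ∈ P, f x ≤ 0) (hfs : ∀ x ∈ s, f x = 0) :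
    ∀ x ∈ P, f x = 0 := by
  by_contra! hne
  obtain ⟨x, hx, hxne⟩ := hne
  obtain ⟨F, hF, hsub, -⟩ := hP.exists_isFacet_superset hd hx (isExposed_sep_eq_zero hf)
    (fun h => hxne h.2)
  obtain ⟨y, ⟨hy, hyF⟩, -⟩ := hs.2.2.2 F hF
  exact hyF (hsub ⟨(hs.2.1 hy).1, hfs y hy⟩)

theorem exists_affineMap_neg (hs : IsSpecialSimplex m P s) (hP : IsPolytope P) (hd : 0 < dim P)
    {x : Fin q → ℝ} (hx : x ∈ s) :
    ∃ f : (Fin q → ℝ) →ᵃ[ℝ] ℝ, (∀ y ∈ P, f y ≤ 0) ∧ f x < 0 ∧ ∀ y ∈ s, y ≠ x → f y = 0 := by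
  have hxP := (hs.2.1 hx).1
  obtain ⟨F, hF, -, hxF⟩ := hP.exists_isFacet_superset hd hxP isExposed_empty (notMem_empty x)
  obtain ⟨f, hf, rfl⟩ := exists_affineMap_of_isExposed hF.1
  refine ⟨f, hf, (hf x hxP).lt_of_ne fun h0 => hxF ⟨hxP, h0⟩, fun y hy hyx => ?_⟩
  by_contra h0
  exact hyx ((hs.2.2.2 _ hF).unique ⟨hy, fun h => h0 h.2⟩ ⟨hx, hxF⟩)

theorem exists_remainingVertices_isMax (hs : IsSpecialSimplex m P s) (hP : IsPolytope P)
    (hd : 0 < dim P) {l : (Fin q → ℝ) →ₗ[ℝ] ℝ} (hls : ∀ x ∈ s, ∀ y ∈ s, l x = l y)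
    (hlP : ¬ ∀ x ∈ P, ∀ y ∈ P, l x = l y) :
    ∃ a ∈ remainingVertices P s, ∀ y ∈ P, l y ≤ l a := by
  obtain ⟨a, ha, hmax⟩ := hP.exists_extremePoint_isMax l.toAffineMap
  refine ⟨a, ⟨ha, fun has => hlP ?_⟩, hmax⟩
  let f : (Fin q → ℝ) →ᵃ[ℝ] ℝ := l.toAffineMap - AffineMap.const ℝ _ (l a)
  have hf : ∀ x, f x = l x - l a := fun x => by simp [f]
  have hconst : ∀ x ∈ P, l x = l a := fun x hx => sub_eq_zero.mp <| hf x ▸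
    hs.eq_zero_of_forall_mem hP hd (fun y hy => hf y ▸ sub_nonpos.mpr (hmax y hy))
      (fun y hy => hf y ▸ sub_eq_zero.mpr (hls y hy a has)) x hx
  exact fun x hx y hy => (hconst x hx).trans (hconst y hy).symm

theorem vectorSpan_le_sup (hs : IsSpecialSimplex m P s) (hP : IsPolytope P) (hd : 0 < dim P) :
    vectorSpan ℝ P ≤ vectorSpan ℝ (s : Set (Fin q → ℝ)) ⊔ vectorSpan ℝ (remainingVertices P s) := by
  refine le_of_forall_le_ker fun l hl => ?_
  rw [sup_le_iff, vectorSpan_le_ker_iff, vectorSpan_le_ker_iff] at hl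
  rw [vectorSpan_le_ker_iff]
  by_contra hlP
  obtain ⟨a, ha, hmax⟩ := hs.exists_remainingVertices_isMax hP hd hl.1 hlP
  obtain ⟨b, hb, hmin⟩ := hs.exists_remainingVertices_isMax hP hd (l := -l)
    (by simpa using hl.1) (by simpa using hlP)
  simp only [LinearMap.neg_apply, neg_le_neg_iff] at hmin
  have hab := hl.2 a ha b hb
  exact hlP fun x hx y hy => by linarith [hmax x hx, hmax y hy, hmin x hx, hmin y hy]

theorem finrank_vectorSpan (hs : IsSpecialSimplex m P s) :
    Module.finrank ℝ (vectorSpan ℝ (s : Set (Fin q → ℝ))) = m := by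
  have hcard : Fintype.card s = m + 1 := (Fintype.card_coe s).trans hs.1
  have hrange : range (fun k : s => (k : Fin q → ℝ)) = s := Subtype.range_coe
  rw [← hrange, hs.2.2.1.finrank_vectorSpan hcard]

theorem remainingVertices_nonempty (hs : IsSpecialSimplex m P s) (hP : IsPolytope P)
    (hd : m < dim P) : (remainingVertices P s).Nonempty := by
  rw [nonempty_iff_ne_empty]
  intro hempty
  have hle := hs.vectorSpan_le_sup hP (by omega)
  rw [hempty, vectorSpan_empty, sup_bot_eq] at hle
  exact hd.not_ge (hs.finrank_vectorSpan ▸ Submodule.finrank_mono hle)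

-- The projection along the simplex maps the span of the remaining vertices onto the span of the
-- basis polytope; meekness says that the dimension does not drop.
theorem disjoint_vectorSpan (hs : IsSpecialSimplex m P s) (hP : IsPolytope P) (hd : 0 < dim P)
    (hmeek : IsMeek P s) :
    Disjoint (vectorSpan ℝ (s : Set (Fin q → ℝ))) (vectorSpan ℝ (remainingVertices P s)) := by
  obtain ⟨d, Q, ⟨π, -, hker, rfl⟩, hdim⟩ := hmeek
  set A := remainingVertices P s
  have hA : A ⊆ restComplexSupport P s := fun x hx =>
    ⟨{x}, ⟨hP.isExposed_singleton hx.1, disjoint_singleton_left.mpr hx.2⟩, rfl⟩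
  have himage : vectorSpan ℝ (π '' P) ≤ (vectorSpan ℝ A).map π := calc
    vectorSpan ℝ (π '' P) = (vectorSpan ℝ P).map π :=
      (AffineMap.map_vectorSpan π.toAffineMap).symm
    _ ≤ (LinearMap.ker π ⊔ vectorSpan ℝ A).map π :=
      Submodule.map_mono (hker ▸ hs.vectorSpan_le_sup hP hd)
    _ = (vectorSpan ℝ A).map π := by
      rw [Submodule.map_sup, LinearMap.le_ker_iff_map.mp le_rfl, bot_sup_eq]
  have hle : Module.finrank ℝ (vectorSpan ℝ A) ≤ Module.finrank ℝ ((vectorSpan ℝ A).map π) := calc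
    Module.finrank ℝ (vectorSpan ℝ A) ≤ dim (restComplexSupport P s) :=
      Submodule.finrank_mono (vectorSpan_mono ℝ hA)
    _ = dim (π '' P) := hdim.symm
    _ ≤ Module.finrank ℝ ((vectorSpan ℝ A).map π) := Submodule.finrank_mono himage
  have hrank := LinearMap.finrank_range_add_finrank_ker (π.domRestrict (vectorSpan ℝ A))
  rw [LinearMap.range_domRestrict] at hrank
  have hker_zero : LinearMap.ker (π.domRestrict (vectorSpan ℝ A)) = ⊥ :=
    Submodule.finrank_eq_zero.mp (by omega)
  rw [← hker, Submodule.disjoint_def]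
  intro u hu huA
  exact congrArg Subtype.val (LinearMap.ker_eq_bot'.mp hker_zero ⟨u, huA⟩ hu)

theorem mem_intrinsicInterior (hs : IsSpecialSimplex m P s) (hP : IsPolytope P) (hd : 0 < dim P)
    (hmeek : IsMeek P s) {p : Fin q → ℝ} (hps : p ∈ affineSpan ℝ (s : Set (Fin q → ℝ)))
    (hpA : p ∈ affineSpan ℝ (remainingVertices P s)) :
    p ∈ intrinsicInterior ℝ (convexHull ℝ (remainingVertices P s)) := by
  refine mem_intrinsicInterior_of_forall_affineMap_eq (convex_convexHull ℝ _)
    (by rwa [affineSpan_convexHull]) fun g hg => ?_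
  obtain ⟨f, hfs, hfA⟩ := exists_affineMap_eqOn_eqOn (hs.disjoint_vectorSpan hP hd hmeek) hps hpA
    (f := AffineMap.const ℝ _ 0) (g := g - AffineMap.const ℝ _ (g p)) (by simp)
  have hfA' : ∀ x ∈ remainingVertices P s, f x = g x - g p := fun x hx => by simp [hfA hx]
  have hf : ∀ x ∈ P, f x ≤ 0 := by
    rw [← hP.convexHull_extremePoints]
    refine affineMap_le_of_mem_convexHull fun x hx => ?_
    by_cases hxs : x ∈ s
    · exact (hfs hxs).le
    · rw [hfA' x ⟨hx, hxs⟩]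
      exact sub_nonpos.mpr (hg x (subset_convexHull ℝ _ ⟨hx, hxs⟩))
  have hgA : EqOn g (AffineMap.const ℝ _ (g p)) (remainingVertices P s) := fun x hx =>
    sub_eq_zero.mp (hfA' x hx ▸ hs.eq_zero_of_forall_mem hP hd hf (fun y hy => hfs hy) x hx.1.1)
  exact (affineMap_eqOn_affineSpan hgA).mono (convexHull_subset_affineSpan _)

theorem weight_nonneg (hs : IsSpecialSimplex m P s) (hP : IsPolytope P) (hd : 0 < dim P)
    {w : s → ℝ} (hw : ∑ k, w k = 1) (hmem : ∑ k, w k • (k : Fin q → ℝ) ∈ P) (k : s) : 0 ≤ w k := by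
  obtain ⟨f, hf, hfk, hf0⟩ := hs.exists_affineMap_neg hP hd k.2
  have hval : f (∑ k, w k • (k : Fin q → ℝ)) = w k * f k := by
    rw [affineMap_sum_smul f _ hw, Fintype.sum_eq_single k fun l hl => by
      rw [hf0 l l.2 fun h => hl (Subtype.ext h), smul_zero], smul_eq_mul]
  exact nonneg_of_mul_nonpos_left (hval ▸ hf _ hmem) hfk

theorem exists_splitHull (hs : IsSpecialSimplex m P s) (hP : IsPolytope P) (hd : m < dim P)
    (hmeek : IsMeek P s) :
    ∃ (lam : s → ℝ) (p : Fin q → ℝ) (C : Set (Fin q → ℝ)),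
      SplitHull (fun k : s => (k : Fin q → ℝ)) lam p C P := by
  have hd₀ : 0 < dim P := by omega
  have hrange : range (fun k : s => (k : Fin q → ℝ)) = s := Subtype.range_coe
  set A := remainingVertices P s with hA
  have hAfin : A.Finite := hP.finite_extremePoints.subset sdiff_subset
  have hAP : A ⊆ P := sdiff_subset.trans extremePoints_subset
  obtain ⟨c, hc⟩ := hs.remainingVertices_nonempty hP hd
  obtain ⟨σ, hσ⟩ : s.Nonempty := Finset.card_pos.mp (by rw [hs.1]; omega)
  obtain ⟨p, hps, hpA⟩ := exists_mem_affineSpan_mem_affineSpan (A := (s : Set (Fin q → ℝ))) hσ hc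
    (hs.vectorSpan_le_sup hP hd₀ (vsub_mem_vectorSpan ℝ (hs.2.1 hσ).1 (hAP hc)))
  have hprel := hs.mem_intrinsicInterior hP hd₀ hmeek hps hpA
  have hpconv : p ∈ convexHull ℝ A := intrinsicInterior_subset hprel
  rw [← hrange] at hps
  obtain ⟨lam, hlam, hp⟩ := eq_affineCombination_of_mem_affineSpan_of_fintype hps
  rw [Finset.affineCombination_eq_linear_combination _ _ _ hlam] at hp
  have hnonneg := hs.weight_nonneg hP hd₀ hlam (hp ▸ convexHull_min hAP hP.convex hpconv)
  refine ⟨lam, p, convexHull ℝ A, {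
    nonneg := hnonneg
    lt_one := fun k => ?_
    sum_eq_one := hlam
    center_eq := hp
    isPolytope_base := ⟨hAfin.toFinset, ⟨c, hAfin.mem_toFinset.mpr hc⟩, by rw [hAfin.coe_toFinset]⟩
    center_mem := hprel
    affineIndependent := hs.2.2.1
    disjoint := by
      rw [hrange, vectorSpan_convexHull]
      exact hs.disjoint_vectorSpan hP hd₀ hmeek
    hull := by
      rw [convexHull_convexHull_union_right, hrange, hA, remainingVertices,
        union_sdiff_cancel hs.2.1, hP.convexHull_extremePoints] }⟩
  by_contra! hk
  rw [sum_smul_eq_of_one_le _ hnonneg hlam hk] at hp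
  exact notMem_convexHull_of_mem_extremePoints hP.convex (hs.2.1 k.2) hAP (fun h => h.2 k.2)
    (hp ▸ hpconv)

end IsSpecialSimplex

end MeekSimplices

section SplitsOver

/-- `P` is a split hull with barycentric weights `lam` whose base is an affine copy of `Q`, the
center of the split hull corresponding to the point `c` of `Q`. These data determine `P` up to
affine isomorphism. -/
def SplitsOver {ι : Type} [Fintype ι] {d q : ℕ} (lam : ι → ℝ) (c : Fin d → ℝ)
    (Q : Set (Fin d → ℝ)) (P : Set (Fin q → ℝ)) : Prop :=
  ∃ (v : ι → Fin q → ℝ) (p : Fin q → ℝ) (C : Set (Fin q → ℝ))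
    (φ : (Fin q → ℝ) →ᵃ[ℝ] (Fin d → ℝ)), SplitHull v lam p C P ∧ BijOn φ C Q ∧ φ p = c

namespace SplitsOver

variable {ι : Type} [Fintype ι] {d q r : ℕ} {lam : ι → ℝ} {c : Fin d → ℝ} {Q : Set (Fin d → ℝ)}
  {P : Set (Fin q → ℝ)} {R : Set (Fin r → ℝ)}

theorem exists_splitHull (h : SplitsOver lam c Q P) :
    ∃ (v : ι → Fin q → ℝ) (p : Fin q → ℝ) (C : Set (Fin q → ℝ)),
      SplitHull v lam p C P ∧ AffEquiv C Q := by
  obtain ⟨v, p, C, φ, hP, hφ, -⟩ := h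
  exact ⟨v, p, C, hP, φ, hφ⟩

theorem isPolytope (h : SplitsOver lam c Q P) : IsPolytope P := by
  obtain ⟨v, p, C, hP, -⟩ := h.exists_splitHull
  exact hP.isPolytope

theorem dim_eq (h : SplitsOver lam c Q P) {m : ℕ} (hm : Fintype.card ι = m + 1) :
    dim P = dim Q + m := by
  obtain ⟨v, p, C, hP, hCQ⟩ := h.exists_splitHull
  rw [hP.dim_eq hm, hCQ.dim_eq hP.isPolytope_base.convex]

theorem exists_isSpecialSimplex (h : SplitsOver lam c Q P) {m : ℕ}
    (hm : Fintype.card ι = m + 1) :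
    ∃ s, IsSpecialSimplex m P s ∧ IsMeek P s ∧
      ∃ (e : ℕ) (B : Set (Fin e → ℝ)), IsBasisPolytope P s B ∧ AffEquiv B Q := by
  classical
  obtain ⟨v, p, C, hP, hCQ⟩ := h.exists_splitHull
  have hs : ((Finset.univ.image v : Finset _) : Set (Fin q → ℝ)) = range v := by simp
  obtain ⟨e, B, hB⟩ := exists_isBasisPolytope P (Finset.univ.image v)
  exact ⟨_, hP.isSpecialSimplex hs hm, hP.isMeek hs, e, B, hB,
    ((hP.affEquiv_of_isBasisPolytope hs hB).symm hP.isPolytope_base.convex).trans hCQ⟩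

theorem affEquiv (h : SplitsOver lam c Q P) (h' : SplitsOver lam c Q R) : AffEquiv P R := by
  obtain ⟨v, p, C, φ, hP, hφ, hp⟩ := h
  obtain ⟨v', p', C', φ', hR, hφ', hp'⟩ := h'
  obtain ⟨ψ, hψ⟩ := exists_affineMap_leftInvOn hR.isPolytope_base.convex hφ'.injOn
  have hψ' : BijOn ψ Q C' := hφ'.symm ⟨hψ.rightInvOn_image.mono hφ'.image_eq.ge, hψ⟩
  refine hP.affEquiv hR (φ := ψ.comp φ) (hψ'.comp hφ) ?_
  rw [AffineMap.comp_apply, hp, ← hp', hψ hR.center_mem_base]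

theorem of_affEquiv (h : SplitsOver lam c Q P) (hPR : AffEquiv P R) : SplitsOver lam c Q R := by
  obtain ⟨v, p, C, φ, hP, hφ, hp⟩ := h
  obtain ⟨f, f', hf, hf', -⟩ := hPR.exists_inverse hP.isPolytope.convex
  have hC : LeftInvOn f' f C := hf'.mono hP.base_subset
  refine ⟨f ∘ v, f p, f '' C, φ.comp f', hf.image_eq ▸ hP.image hf.injOn, ?_, ?_⟩
  · exact hφ.comp ((hf.injOn.mono hP.base_subset).bijOn_image.symm ⟨hC.rightInvOn_image, hC⟩)
  · rw [AffineMap.comp_apply, hC hP.center_mem_base, hp]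

theorem reindex {κ : Type} [Fintype κ] (h : SplitsOver lam c Q P) (e : κ ≃ ι) :
    SplitsOver (lam ∘ e) c Q P := by
  obtain ⟨v, p, C, φ, hP, hφ⟩ := h
  exact ⟨v ∘ e, p, C, φ, hP.reindex e, hφ⟩

end SplitsOver

end SplitsOver

section Pyramids

theorem range_option_elim {α ι : Type*} (a : α) (v : ι → α) :
    (range fun o : Option ι => o.elim a v) = insert a (range v) := by
  ext x
  simp [Option.exists, eq_comm]

theorem affineIndependent_option_elim {V ι : Type*} [AddCommGroup V] [Module ℝ V] {v : ι → V}
    (hv : AffineIndependent ℝ v) {a : V} (ha : a ∉ affineSpan ℝ (range v)) :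
    AffineIndependent ℝ fun o : Option ι => o.elim a v := by
  have himage : (fun o : Option ι => o.elim a v) '' {o | o ≠ none} ⊆ range v := by
    rintro _ ⟨_ | k, hk, rfl⟩
    exacts [absurd rfl hk, ⟨k, rfl⟩]
  refine AffineIndependent.affineIndependent_of_notMem_span (i := none) ?_
    fun hmem => ha (affineSpan_mono ℝ himage hmem)
  exact (affineIndependent_equiv ((Equiv.optionIsSomeEquiv ι).symm.trans
    (Equiv.subtypeEquivRight fun _ => Option.isSome_iff_ne_none))).mp hv

theorem disjoint_vectorSpan_insert {V : Type*} [AddCommGroup V] [Module ℝ V] {A C : Set V} {a : V}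
    (hA : A.Nonempty) (hAC : Disjoint (vectorSpan ℝ A) (vectorSpan ℝ C)) {f : V →ᵃ[ℝ] ℝ}
    (hfA : ∀ x ∈ A, f x = 0) (hfC : ∀ x ∈ C, f x = 0) (ha : f a ≠ 0) :
    Disjoint (vectorSpan ℝ (insert a A)) (vectorSpan ℝ C) := by
  obtain ⟨b, hb⟩ := hA
  have hker : ∀ {D : Set V}, (∀ x ∈ D, f x = 0) → ∀ u ∈ vectorSpan ℝ D, f.linear u = 0 :=
    fun hD u hu => affineMap_linear_eq_zero_of_mem_vectorSpan hD hu
  have hspan : vectorSpan ℝ (insert a A) = Submodule.span ℝ {a - b} ⊔ vectorSpan ℝ A := by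
    rw [← direction_affineSpan, ← affineSpan_insert_affineSpan,
      AffineSubspace.direction_affineSpan_insert (mem_affineSpan ℝ hb), direction_affineSpan,
      vsub_eq_sub]
  rw [hspan, Submodule.disjoint_def]
  intro x hx hxC
  obtain ⟨_, hy, u, hu, rfl⟩ := Submodule.mem_sup.mp hx
  obtain ⟨t, rfl⟩ := Submodule.mem_span_singleton.mp hy
  have ht : t * f a = 0 := by
    have hzero := hker hfC _ hxC
    rwa [map_add, map_smul, hker hfA u hu, add_zero, affineMap_linear_sub, hfA b hb, sub_zero,
      smul_eq_mul] at hzero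
  have ht0 : t = 0 := (mul_eq_zero.mp ht).resolve_right ha
  rw [ht0, zero_smul, zero_add] at hxC ⊢
  exact Submodule.disjoint_def.mp hAC u hu hxC

theorem SplitHull.insert_apex {ι : Type} [Fintype ι] {q : ℕ} {v : ι → Fin q → ℝ} {lam : ι → ℝ}
    {p a : Fin q → ℝ} {C P : Set (Fin q → ℝ)} (h : SplitHull v lam p C P)
    {f : (Fin q → ℝ) →ᵃ[ℝ] ℝ} (hf : ∀ x ∈ P, f x = 0) (ha : f a ≠ 0) :
    SplitHull (fun o : Option ι => o.elim a v) (fun o => o.elim 0 lam) p C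
      (convexHull ℝ (insert a P)) where
  nonneg k := by cases k <;> simp [h.nonneg]
  lt_one k := by cases k <;> simp [h.lt_one]
  sum_eq_one := by simp [Fintype.sum_option, h.sum_eq_one]
  center_eq := by simp [Fintype.sum_option, h.center_eq]
  isPolytope_base := h.isPolytope_base
  center_mem := h.center_mem
  affineIndependent := by
    refine affineIndependent_option_elim h.affineIndependent fun hmem => ha ?_
    have hrange : EqOn f (AffineMap.const ℝ _ 0) (range v) :=
      forall_mem_range.mpr fun k => hf _ (h.point_mem k)
    exact affineMap_eqOn_affineSpan hrange hmem
  disjoint := by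
    have hne : (range v).Nonempty := (affineSpan_nonempty ℝ).mp ⟨p, h.center_mem_affineSpan⟩
    rw [range_option_elim]
    exact disjoint_vectorSpan_insert hne h.disjoint
      (forall_mem_range.mpr fun k => hf _ (h.point_mem k)) (fun x hx => hf x (h.base_subset hx)) ha
  hull := by
    rw [h.hull, insert_eq, convexHull_convexHull_union_right, ← union_assoc, ← insert_eq,
      range_option_elim]

/-- The inclusion of `ℝᵈ` as the base hyperplane of `ℝᵈ⁺¹`. -/
def snocZero (d : ℕ) : (Fin d → ℝ) →ₗ[ℝ] (Fin (d + 1) → ℝ) where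
  toFun x := Fin.snoc (α := fun _ => ℝ) x 0
  map_add' x y := by ext k; refine Fin.lastCases ?_ (fun k => ?_) k <;> simp
  map_smul' c x := by ext k; refine Fin.lastCases ?_ (fun k => ?_) k <;> simp

theorem snocZero_injective (d : ℕ) : Function.Injective (snocZero d) :=
  fun _ _ h => (Fin.snoc_injective2 (α := fun _ => ℝ) h).1

namespace SplitsOver

variable {ι : Type} [Fintype ι] {d q : ℕ} {lam : ι → ℝ} {c : Fin d → ℝ} {Q : Set (Fin d → ℝ)}
  {K : Set (Fin q → ℝ)}

theorem pyr (h : SplitsOver lam c Q K) :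
    SplitsOver (fun o : Option ι => o.elim 0 lam) c Q (pyr K) := by
  obtain ⟨v, p, C, φ, hK, hφ⟩ := h.of_affEquiv
    ⟨(snocZero q).toAffineMap, (snocZero_injective q).injOn.bijOn_image⟩
  refine ⟨_, p, C, φ, hK.insert_apex (a := Fin.snoc (α := fun _ => ℝ) (0 : Fin q → ℝ) 1)
    (f := (LinearMap.proj (Fin.last q) : (Fin (q + 1) → ℝ) →ₗ[ℝ] ℝ).toAffineMap) ?_ ?_, hφ⟩
  · rw [forall_mem_image]
    intro x _
    simp [snocZero]
  · simp

theorem pyrIter (h : SplitsOver lam c Q K) (i : ℕ) :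
    SplitsOver (Sum.elim lam 0 : ι ⊕ Fin i → ℝ) c Q (pyrIter K i) := by
  induction i with
  | zero =>
    have hlam : lam ∘ Equiv.sumEmpty ι (Fin 0) = Sum.elim lam 0 := by
      ext (k | k)
      exacts [rfl, k.elim0]
    exact hlam ▸ h.reindex (Equiv.sumEmpty ι (Fin 0))
  | succ i ih =>
    let e : ι ⊕ Fin (i + 1) ≃ Option (ι ⊕ Fin i) :=
      ((Equiv.sumCongr (Equiv.refl ι)
        (finSuccEquivLast.trans (Equiv.optionEquivSumPUnit.{0} (Fin i)))).trans
        (Equiv.sumAssoc ι (Fin i) PUnit).symm).trans (Equiv.optionEquivSumPUnit _).symm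
    have hlam : (fun o : Option (ι ⊕ Fin i) => o.elim 0 (Sum.elim lam 0)) ∘ e = Sum.elim lam 0 := by
      ext (k | k)
      · simp [e]
      · refine Fin.lastCases ?_ (fun k => ?_) k <;> simp [e]
    exact hlam ▸ ih.pyr.reindex e

end SplitsOver

end Pyramids

section DirectSums

variable {a b : ℕ}

/-- The inclusion of the first summand of `ℝᵃ⁺ᵇ`. -/
def appendZero (a b : ℕ) : (Fin a → ℝ) →ₗ[ℝ] (Fin (a + b) → ℝ) where
  toFun x := Fin.append x 0
  map_add' x y := by ext k; refine Fin.addCases (fun k => ?_) (fun k => ?_) k <;> simp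
  map_smul' c x := by ext k; refine Fin.addCases (fun k => ?_) (fun k => ?_) k <;> simp

/-- The inclusion of the second summand of `ℝᵃ⁺ᵇ`. -/
def zeroAppend (a b : ℕ) : (Fin b → ℝ) →ₗ[ℝ] (Fin (a + b) → ℝ) where
  toFun x := Fin.append 0 x
  map_add' x y := by ext k; refine Fin.addCases (fun k => ?_) (fun k => ?_) k <;> simp
  map_smul' c x := by ext k; refine Fin.addCases (fun k => ?_) (fun k => ?_) k <;> simp

theorem append_eq_add (x : Fin a → ℝ) (y : Fin b → ℝ) :
    Fin.append x y = appendZero a b x + zeroAppend a b y := by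
  ext k
  refine Fin.addCases (fun k => ?_) (fun k => ?_) k <;> simp [appendZero, zeroAppend]

theorem appendZero_injective : Function.Injective (appendZero a b) := fun x y h =>
  funext fun k => by simpa [appendZero] using congrFun h (Fin.castAdd b k)

theorem disjoint_range_appendZero_zeroAppend :
    Disjoint (LinearMap.range (appendZero a b)) (LinearMap.range (zeroAppend a b)) := by
  rw [Submodule.disjoint_def]
  rintro _ ⟨x, rfl⟩ ⟨y, hxy⟩
  have hx : x = 0 := funext fun k => by
    simpa [appendZero, zeroAppend] using (congrFun hxy (Fin.castAdd b k)).symm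
  rw [hx, map_zero]

theorem vectorSpan_image_le_range {V W : Type*} [AddCommGroup V] [Module ℝ V] [AddCommGroup W]
    [Module ℝ W] (f : V →ₗ[ℝ] W) (A : Set V) : vectorSpan ℝ (f '' A) ≤ LinearMap.range f := by
  rw [vectorSpan_le_iff]
  rintro _ ⟨x, -, rfl⟩ _ ⟨y, -, rfl⟩
  exact ⟨x - y, map_sub f x y⟩

theorem directSum_eq_convexHull {S : Set (Fin a → ℝ)} {Q : Set (Fin b → ℝ)} (hS : Convex ℝ S)
    (hSne : S.Nonempty) (hQ : Convex ℝ Q) (hQ0 : (0 : Fin b → ℝ) ∈ Q) :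
    directSum S Q = convexHull ℝ (appendZero a b '' S ∪ zeroAppend a b '' Q) := by
  apply Subset.antisymm
  · rintro _ ⟨x, hx, y, hy, l₁, l₂, h₁, h₂, hl, rfl⟩
    have hmem : ∀ i : Fin 3, ![appendZero a b x, zeroAppend a b y, 0] i ∈
        convexHull ℝ (appendZero a b '' S ∪ zeroAppend a b '' Q) := fun i => by
      apply subset_convexHull
      fin_cases i
      exacts [Or.inl ⟨x, hx, rfl⟩, Or.inr ⟨y, hy, rfl⟩, Or.inr ⟨0, hQ0, map_zero _⟩]
    have hsum := (convex_convexHull ℝ _).sum_mem (t := Finset.univ) (w := ![l₁, l₂, 1 - l₁ - l₂])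
      (fun i _ => by fin_cases i <;> simp <;> linarith) (by simp [Fin.sum_univ_three])
      fun i _ => hmem i
    simpa [Fin.sum_univ_three, append_eq_add] using hsum
  · rw [convexHull_union (hSne.image _) (Nonempty.image _ ⟨0, hQ0⟩),
      (hS.linear_image _).convexHull_eq, (hQ.linear_image _).convexHull_eq]
    intro z hz
    rw [mem_convexJoin] at hz
    obtain ⟨_, ⟨x, hx, rfl⟩, _, ⟨y, hy, rfl⟩, l₁, l₂, h₁, h₂, hl, rfl⟩ := hz
    exact ⟨x, hx, y, hy, l₁, l₂, h₁, h₂, hl.le, by rw [append_eq_add, map_smul, map_smul]⟩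

theorem lt_one_of_sum_eq_one {ι : Type*} [Fintype ι] [Nontrivial ι] {lam : ι → ℝ}
    (hpos : ∀ k, 0 < lam k) (hsum : ∑ k, lam k = 1) (k : ι) : lam k < 1 := by
  obtain ⟨l, hl⟩ := exists_ne k
  rw [← hsum]
  exact Finset.single_lt_sum hl (Finset.mem_univ k) (Finset.mem_univ l) (hpos l)
    fun l _ _ => (hpos l).le

theorem splitHull_directSum {ι : Type} [Fintype ι] [Nontrivial ι] {w : ι → Fin a → ℝ}
    (hw : AffineIndependent ℝ w) {lam : ι → ℝ} (hpos : ∀ k, 0 < lam k) (hsum : ∑ k, lam k = 1)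
    (hlam : ∑ k, lam k • w k = 0) {Q : Set (Fin b → ℝ)} (hQ : IsPolytope Q)
    (hQ0 : (0 : Fin b → ℝ) ∈ intrinsicInterior ℝ Q) :
    SplitHull (appendZero a b ∘ w) lam 0 (zeroAppend a b '' Q)
      (directSum (convexHull ℝ (range w)) Q) where
  nonneg k := (hpos k).le
  lt_one := lt_one_of_sum_eq_one hpos hsum
  sum_eq_one := hsum
  center_eq := by
    simpa only [map_sum, map_smul, map_zero, Function.comp_apply]
    using congrArg (appendZero a b) hlam.symm
  isPolytope_base := hQ.image (zeroAppend a b).toAffineMap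
  center_mem := by
    simpa using map_mem_intrinsicInterior_image hQ.convex hQ0 (zeroAppend a b).toAffineMap
  affineIndependent := hw.map' (appendZero a b).toAffineMap appendZero_injective
  disjoint := by
    rw [range_comp]
    exact disjoint_range_appendZero_zeroAppend.mono (vectorSpan_image_le_range _ _)
      (vectorSpan_image_le_range _ _)
  hull := by
    rw [directSum_eq_convexHull (convex_convexHull ℝ _) (range_nonempty w).convexHull hQ.convex
      (intrinsicInterior_subset hQ0), (appendZero a b).image_convexHull,
      convexHull_convexHull_union_left, range_comp]

theorem splitsOver_directSum {ι : Type} [Fintype ι] [Nontrivial ι] {w : ι → Fin a → ℝ}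
    (hw : AffineIndependent ℝ w) {lam : ι → ℝ} (hpos : ∀ k, 0 < lam k) (hsum : ∑ k, lam k = 1)
    {Q : Set (Fin b → ℝ)} (hQ : IsPolytope Q) {c : Fin b → ℝ} (hc : c ∈ intrinsicInterior ℝ Q) :
    SplitsOver lam c Q (directSum ((fun x => x - ∑ k, lam k • w k) '' convexHull ℝ (range w))
      ((fun x => x - c) '' Q)) := by
  set b₀ := ∑ k, lam k • w k
  let τ : (Fin a → ℝ) →ᵃ[ℝ] (Fin a → ℝ) := AffineMap.id ℝ _ - AffineMap.const ℝ _ b₀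
  let σ : (Fin b → ℝ) →ᵃ[ℝ] (Fin b → ℝ) := AffineMap.id ℝ _ - AffineMap.const ℝ _ c
  have hτ : (fun x => x - b₀) '' convexHull ℝ (range w) = convexHull ℝ (range (τ ∘ w)) := by
    rw [range_comp]
    exact τ.image_convexHull (range w)
  have hsum_zero : ∑ k, lam k • (τ ∘ w) k = 0 :=
    (affineMap_sum_smul τ w hsum).symm.trans (sub_self b₀)
  have hc_zero : (0 : Fin b → ℝ) ∈ intrinsicInterior ℝ (σ '' Q) := by
    have hσc : σ c = 0 := sub_self c
    exact hσc ▸ map_mem_intrinsicInterior_image hQ.convex hc σ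
  let σ' : (Fin (a + b) → ℝ) →ᵃ[ℝ] (Fin b → ℝ) :=
    (LinearMap.funLeft ℝ ℝ (Fin.natAdd a)).toAffineMap + AffineMap.const ℝ _ c
  have hσ' : LeftInvOn σ' (fun x => zeroAppend a b (σ x)) Q := fun x _ => by
    ext k
    simp [σ', σ, zeroAppend, LinearMap.funLeft_apply]
  rw [hτ]
  refine ⟨_, 0, _, σ', splitHull_directSum (hw.map' τ (sub_left_injective (b := b₀))) hpos hsum
    hsum_zero (hQ.image σ) hc_zero, ?_, by simp [σ']⟩
  rw [image_image]
  exact hσ'.injOn.bijOn_image.symm ⟨hσ'.rightInvOn_image, hσ'⟩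

end DirectSums

section PyramidsOverSums

theorem sum_smul_mem_intrinsicInterior_iff {ι : Type*} [Fintype ι] {q : ℕ} {w : ι → Fin q → ℝ}
    (hw : AffineIndependent ℝ w) {lam : ι → ℝ} (hsum : ∑ k, lam k = 1) :
    ∑ k, lam k • w k ∈ intrinsicInterior ℝ (convexHull ℝ (range w)) ↔ ∀ k, 0 < lam k := by
  classical
  constructor
  · intro hb k
    obtain ⟨f, hf⟩ := exists_affineMap_apply_eq hw (-Pi.single k 1 : ι → ℝ)
    have hfb : f (∑ k, lam k • w k) = -lam k := by
      simp [affineMap_sum_smul f w hsum, hf, Pi.single_apply]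
    by_contra! hk
    have hle : ∀ x ∈ convexHull ℝ (range w), f x ≤ f (∑ k, lam k • w k) := by
      refine affineMap_le_of_mem_convexHull (forall_mem_range.mpr fun l => ?_)
      rw [hf, hfb, Pi.neg_apply, Pi.single_apply]
      split_ifs <;> linarith
    have heq := eq_of_le_of_mem_intrinsicInterior hb hle (w k) (subset_convexHull ℝ _ ⟨k, rfl⟩)
    rw [hf, hfb, Pi.neg_apply, Pi.single_eq_same, neg_inj] at heq
    linarith
  · intro hpos
    refine mem_intrinsicInterior_of_forall_affineMap_eq (convex_convexHull ℝ _)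
      (affineSpan_mono ℝ (subset_convexHull ℝ _) (sum_smul_mem_affineSpan hsum)) fun g hg => ?_
    set y := g (∑ k, lam k • w k) with hy
    have hle : ∀ k, g (w k) ≤ y := fun k => hg _ (subset_convexHull ℝ _ ⟨k, rfl⟩)
    have hzero : ∑ k, lam k * (y - g (w k)) = 0 := by
      simp only [mul_sub, Finset.sum_sub_distrib, ← Finset.sum_mul, hsum, one_mul]
      rw [hy, affineMap_sum_smul g w hsum]
      simp
    have heq : EqOn g (AffineMap.const ℝ _ y) (range w) := forall_mem_range.mpr fun k => by
      have hk := (Finset.sum_eq_zero_iff_of_nonneg fun k _ =>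
        mul_nonneg (hpos k).le (sub_nonneg.mpr (hle k))).mp hzero k (Finset.mem_univ k)
      exact (sub_eq_zero.mp ((mul_eq_zero.mp hk).resolve_left (hpos k).ne')).symm
    exact (affineMap_eqOn_affineSpan heq).mono (convexHull_subset_affineSpan _)

variable {i j d : ℕ} {Q : Set (Fin d → ℝ)}

theorem IsPyramidOverSum.exists_splitsOver {R : Set (Fin (j + d + i) → ℝ)}
    (h : IsPyramidOverSum i j Q R) (hj : 0 < j) (hQ : IsPolytope Q) :
    ∃ (lam : Fin (j + 1) → ℝ) (c : Fin d → ℝ),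
      (∀ k, 0 < lam k) ∧ SplitsOver (Sum.elim lam 0 : Fin (j + 1) ⊕ Fin i → ℝ) c Q R := by
  have : Nontrivial (Fin (j + 1)) := Fin.nontrivial_iff_two_le.mpr (by omega)
  obtain ⟨S, b, c, ⟨w, hw, rfl⟩, hb, hc, rfl⟩ := h
  obtain ⟨lam, hsum, rfl⟩ := eq_affineCombination_of_mem_affineSpan_of_fintype
    (convexHull_subset_affineSpan (𝕜 := ℝ) _ (intrinsicInterior_subset hb))
  rw [Finset.affineCombination_eq_linear_combination _ _ _ hsum] at hb ⊢
  have hpos := (sum_smul_mem_intrinsicInterior_iff hw hsum).mp hb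
  exact ⟨lam, c, hpos, (splitsOver_directSum hw hpos hsum hQ hc).pyrIter i⟩

theorem exists_isPyramidOverSum_splitsOver (i : ℕ) (hj : 0 < j) (hQ : IsPolytope Q)
    {lam : Fin (j + 1) → ℝ} (hpos : ∀ k, 0 < lam k) (hsum : ∑ k, lam k = 1) {c : Fin d → ℝ}
    (hc : c ∈ intrinsicInterior ℝ Q) :
    ∃ R, IsPyramidOverSum i j Q R ∧
      SplitsOver (Sum.elim lam 0 : Fin (j + 1) ⊕ Fin i → ℝ) c Q R := by
  have : Nontrivial (Fin (j + 1)) := Fin.nontrivial_iff_two_le.mpr (by omega)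
  obtain ⟨B⟩ := AffineBasis.exists_affineBasis_of_finiteDimensional (k := ℝ)
    (P := Fin j → ℝ) (ι := Fin (j + 1)) (by simp)
  exact ⟨_, ⟨_, _, c, ⟨B, B.ind, rfl⟩, (sum_smul_mem_intrinsicInterior_iff B.ind hsum).mpr hpos, hc,
    rfl⟩, (splitsOver_directSum B.ind hpos hsum hQ hc).pyrIter i⟩

theorem exists_isPyramidOverSum (i : ℕ) (hj : 0 < j) (hQ : IsPolytope Q) :
    ∃ R, IsPyramidOverSum i j Q R := by
  obtain ⟨c, hc⟩ := hQ.nonempty.intrinsicInterior hQ.convex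
  obtain ⟨R, hR, -⟩ := exists_isPyramidOverSum_splitsOver i hj hQ
    (lam := fun _ => ((j : ℝ) + 1)⁻¹) (fun _ => by positivity)
    (by simp [Nat.cast_add_one_ne_zero]) hc
  exact ⟨R, hR⟩

theorem exists_ne_pos_of_sum_eq_one {ι : Type*} [Fintype ι] {lam : ι → ℝ}
    (hlt : ∀ k, lam k < 1) (hsum : ∑ k, lam k = 1) : ∃ k l, k ≠ l ∧ 0 < lam k ∧ 0 < lam l := by
  classical
  have exists_pos : ∀ t : Finset ι, 0 < ∑ k ∈ t, lam k → ∃ k ∈ t, 0 < lam k := fun t ht =>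
    Finset.exists_lt_of_sum_lt (f := fun _ => 0) (by simpa using ht)
  obtain ⟨k, -, hk⟩ := exists_pos Finset.univ (hsum ▸ one_pos)
  have herase : 0 < ∑ l ∈ Finset.univ.erase k, lam l := by
    linarith [Finset.add_sum_erase Finset.univ lam (Finset.mem_univ k), hlt k]
  obtain ⟨l, hl, hl'⟩ := exists_pos _ herase
  exact ⟨k, l, (Finset.ne_of_mem_erase hl).symm, hk, hl'⟩

theorem exists_equiv_sum_comp_eq {ι : Type} [Fintype ι] {m : ℕ} (hm : Fintype.card ι = m + 1)
    {lam : ι → ℝ} (hnonneg : ∀ k, 0 ≤ lam k) (hlt : ∀ k, lam k < 1) (hsum : ∑ k, lam k = 1) :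
    ∃ (i j : ℕ) (e : Fin (j + 1) ⊕ Fin i ≃ ι) (lam' : Fin (j + 1) → ℝ),
      0 < j ∧ i + j = m ∧ lam ∘ e = Sum.elim lam' 0 ∧ (∀ k, 0 < lam' k) ∧ ∑ k, lam' k = 1 := by
  classical
  obtain ⟨a, b, hab, ha, hb⟩ := exists_ne_pos_of_sum_eq_one hlt hsum
  have hcard : 1 < Fintype.card {k // 0 < lam k} :=
    Fintype.one_lt_card_iff.mpr ⟨⟨a, ha⟩, ⟨b, hb⟩, fun h => hab (congrArg Subtype.val h)⟩
  obtain ⟨j, hj⟩ := Nat.exists_eq_succ_of_ne_zero (zero_lt_one.trans hcard).ne'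
  let ej := (Fintype.equivFinOfCardEq hj).symm
  let ei := (Fintype.equivFin {k // ¬ 0 < lam k}).symm
  let e := (Equiv.sumCongr ej ei).trans (Equiv.sumCompl fun k => 0 < lam k)
  have he : lam ∘ e = Sum.elim (fun k => lam (ej k)) 0 := by
    ext (k | k)
    exacts [rfl, (not_lt.mp (ei k).2).antisymm (hnonneg _)]
  refine ⟨_, j, e, _, ?_, ?_, he, fun k => (ej k).2, ?_⟩
  · omega
  · have := Fintype.card_congr e
    rw [Fintype.card_sum, Fintype.card_fin, Fintype.card_fin] at this
    omega
  · have hsum' : ∑ k, (lam ∘ e) k = 1 := (e.sum_comp lam).trans hsum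
    rw [he] at hsum'
    simpa [Fintype.sum_sum_type] using hsum'

theorem SplitsOver.exists_isPyramidOverSum {ι : Type} [Fintype ι] {q m : ℕ} {lam : ι → ℝ}
    {c : Fin d → ℝ} {P : Set (Fin q → ℝ)} (h : SplitsOver lam c Q P)
    (hm : Fintype.card ι = m + 1) :
    ∃ (i j : ℕ) (R : Set (Fin (j + d + i) → ℝ)),
      0 < j ∧ i + j = m ∧ IsPyramidOverSum i j Q R ∧ AffEquiv P R := by
  obtain ⟨v, p, C, φ, hP, hφ, rfl⟩ := id h
  have hQ : IsPolytope Q := hφ.image_eq ▸ hP.isPolytope_base.image φ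
  have hc : φ p ∈ intrinsicInterior ℝ Q :=
    hφ.image_eq ▸ map_mem_intrinsicInterior_image hP.isPolytope_base.convex hP.center_mem φ
  obtain ⟨i, j, e, lam', hj, hij, he, hpos, hsum⟩ :=
    exists_equiv_sum_comp_eq hm hP.nonneg hP.lt_one hP.sum_eq_one
  obtain ⟨R, hR, hR'⟩ := exists_isPyramidOverSum_splitsOver i hj hQ hpos hsum hc
  exact ⟨i, j, R, hj, hij, hR, (he ▸ h.reindex e).affEquiv hR'⟩

end PyramidsOverSums

section FaceLattices

/-- The pairs of a set of indices and a face of `C` that describe the faces of a split hull with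
base `C`, where `J` is the set of indices of nonzero weight: a face contains all points with index
in `J` if and only if it contains the center of the split hull, that is, all of `C`. -/
abbrev FacePairs {ι : Type} {q : ℕ} (J : Set ι) (C : Set (Fin q → ℝ)) : Type :=
  {x : Set ι × FaceLattice C // J ⊆ x.1 ↔ x.2.1 = C}

namespace SplitHull

variable {ι : Type} [Fintype ι] {q : ℕ} {v : ι → Fin q → ℝ} {lam : ι → ℝ} {p : Fin q → ℝ}
  {A : Set ι} {C P F G : Set (Fin q → ℝ)}

theorem isExposed_inter_base (h : SplitHull v lam p C P) (hF : IsExposed ℝ P F) :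
    IsExposed ℝ C (F ∩ C) := by
  obtain ⟨f, hf, rfl⟩ := exists_affineMap_of_isExposed hF
  rw [inter_comm, ← sep_eq_inter_sep h.base_subset]
  exact isExposed_sep_eq_zero fun x hx => hf x (h.base_subset hx)

theorem support_subset_iff (h : SplitHull v lam p C P) (hF : IsExposed ℝ P F) :
    Function.support lam ⊆ {k | v k ∈ F} ↔ F ∩ C = C := by
  obtain ⟨f, hf, rfl⟩ := exists_affineMap_of_isExposed hF
  rw [inter_eq_right]
  constructor
  · exact fun hJ x hx => ⟨h.base_subset hx,
      h.eq_zero_on_base hf (fun k hk => (hJ (Function.mem_support.mpr hk.ne')).2) x hx⟩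
  · exact fun hC k hk => ⟨h.point_mem k,
      h.eq_zero_at_point hf (hC h.center_mem_base).2 ((h.nonneg k).lt_of_ne' hk)⟩

theorem subset_of_forall_mem (h : SplitHull v lam p C P) (hF : IsExposed ℝ P F)
    (hG : IsExposed ℝ P G) (hv : ∀ k, v k ∈ F → v k ∈ G) (hC : F ∩ C ⊆ G) : F ⊆ G := by
  obtain ⟨f, hf, rfl⟩ := exists_affineMap_of_isExposed hF
  rw [h.sep_eq_zero hf]
  refine convexHull_min ?_ (hG.convex h.isPolytope.convex)
  rintro x ⟨⟨k, rfl⟩ | hx, hfx⟩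
  exacts [hv k ⟨h.point_mem k, hfx⟩, hC ⟨⟨h.base_subset hx, hfx⟩, hx⟩]

theorem exists_isExposed_of_weights (h : SplitHull v lam p C P) {α : ι → ℝ}
    {g : (Fin q → ℝ) →ᵃ[ℝ] ℝ} (hα : ∀ k, α k ≤ 0) (hg : ∀ x ∈ C, g x ≤ 0)
    (hp : g p = ∑ k, lam k • α k) :
    ∃ F, IsExposed ℝ P F ∧ {k | v k ∈ F} = {k | α k = 0} ∧ F ∩ C = {x ∈ C | g x = 0} := by
  obtain ⟨f, hfv, hfC⟩ := h.exists_extension α g hp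
  have hf : ∀ x ∈ P, f x ≤ 0 :=
    h.le_of_forall_le (fun k => (hfv k).trans_le (hα k)) fun x hx => (hfC hx).trans_le (hg x hx)
  refine ⟨{x ∈ P | f x = 0}, isExposed_sep_eq_zero hf, ?_, ?_⟩
  · ext k
    simp only [mem_ofPred_eq, h.point_mem k, true_and, hfv]
  · ext x
    constructor
    · exact fun ⟨⟨_, hfx⟩, hx⟩ => ⟨hx, hfC hx ▸ hfx⟩
    · exact fun ⟨hx, hgx⟩ => ⟨⟨h.base_subset hx, (hfC hx).trans hgx⟩, hx⟩

theorem exists_isExposed_of_support_subset (h : SplitHull v lam p C P)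
    (hA : Function.support lam ⊆ A) : ∃ F, IsExposed ℝ P F ∧ {k | v k ∈ F} = A ∧ F ∩ C = C := by
  classical
  obtain ⟨F, hF, hFv, hFC⟩ := h.exists_isExposed_of_weights (α := fun k => if k ∈ A then 0 else -1)
    (g := AffineMap.const ℝ _ 0) (fun k => by split_ifs <;> norm_num) (fun x _ => le_rfl) <| by
      refine (Finset.sum_eq_zero fun k _ => ?_).symm
      by_cases hk : lam k = 0
      · rw [hk, zero_smul]
      · rw [if_pos (hA hk), smul_zero]
  exact ⟨F, hF, by simpa using hFv, by simpa using hFC⟩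

theorem exists_isExposed_of_ne_base (h : SplitHull v lam p C P)
    (hA : ¬ Function.support lam ⊆ A) (hG : IsExposed ℝ C G) (hGC : G ≠ C) :
    ∃ F, IsExposed ℝ P F ∧ {k | v k ∈ F} = A ∧ F ∩ C = G := by
  classical
  obtain ⟨g, hg, rfl⟩ := exists_affineMap_of_isExposed hG
  have hgp : g p < 0 := (hg p h.center_mem_base).lt_of_ne fun hgp => hGC <|
    sep_eq_self_iff_mem_true.mpr fun x hx => (eq_of_le_of_mem_intrinsicInterior h.center_mem
      (fun y hy => (hg y hy).trans_eq hgp.symm) x hx).trans hgp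
  obtain ⟨a, ha, haA⟩ := not_subset.mp hA
  have hpos : 0 < ∑ k, if k ∈ A then 0 else lam k := by
    refine Finset.sum_pos' (fun k _ => ?_) ⟨a, Finset.mem_univ a, ?_⟩
    · split_ifs
      exacts [le_rfl, h.nonneg k]
    · rw [if_neg haA]
      exact (h.nonneg a).lt_of_ne' ha
  set τ := ∑ k, if k ∈ A then 0 else lam k
  have hτ : g p / τ < 0 := div_neg_of_neg_of_pos hgp hpos
  obtain ⟨F, hF, hFv, hFC⟩ := h.exists_isExposed_of_weights
    (α := fun k => if k ∈ A then 0 else g p / τ) (g := g)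
    (fun k => by split_ifs; exacts [le_rfl, hτ.le]) hg <| by
      have hterm : ∀ k, lam k • (if k ∈ A then 0 else g p / τ) =
          (if k ∈ A then 0 else lam k) * (g p / τ) := fun k => by split_ifs <;> simp
      simp only [hterm, ← Finset.sum_mul]
      exact (mul_div_cancel₀ _ hpos.ne').symm
  exact ⟨F, hF, by simpa [hτ.ne] using hFv, hFC⟩

theorem nonempty_faceLattice_orderIso (h : SplitHull v lam p C P) :
    Nonempty (FaceLattice P ≃o FacePairs (Function.support lam) C) := by
  let toPair : FaceLattice P → FacePairs (Function.support lam) C := fun F =>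
    ⟨({k | v k ∈ F.1}, ⟨F.1 ∩ C, h.isExposed_inter_base F.2⟩), h.support_subset_iff F.2⟩
  have hle : ∀ F G, toPair F ≤ toPair G ↔ F ≤ G := fun F G =>
    ⟨fun ⟨hv, hC⟩ => h.subset_of_forall_mem F.2 G.2 hv fun _ hx => (hC hx).1,
      fun hFG => ⟨fun _ hk => hFG hk, inter_subset_inter_left C hFG⟩⟩
  refine ⟨RelIso.ofSurjective (OrderEmbedding.ofMapLEIff toPair hle) ?_⟩
  rintro ⟨⟨A, G, hG⟩, hAG⟩
  obtain ⟨F, hF, hFA, hFG⟩ : ∃ F, IsExposed ℝ P F ∧ {k | v k ∈ F} = A ∧ F ∩ C = G := by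
    by_cases hGC : G = C
    · exact hGC ▸ h.exists_isExposed_of_support_subset (hAG.mpr hGC)
    · exact h.exists_isExposed_of_ne_base (mt hAG.mp hGC) hG hGC
  exact ⟨⟨F, hF⟩, Subtype.ext (Prod.ext hFA (Subtype.ext hFG))⟩

end SplitHull

variable {ι : Type} {q r : ℕ} {C : Set (Fin q → ℝ)} {D : Set (Fin r → ℝ)}

theorem FaceLattice.eq_self_iff (G : FaceLattice C) : G.1 = C ↔ ∀ H : FaceLattice C, H ≤ G :=
  ⟨fun hG H => H.2.subset.trans hG.ge,
    fun hG => G.2.subset.antisymm (hG ⟨C, IsExposed.refl C⟩)⟩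

theorem FaceLattice.orderIso_eq_self_iff (E : FaceLattice C ≃o FaceLattice D) (G : FaceLattice C) :
    (E G).1 = D ↔ G.1 = C := by
  simp only [FaceLattice.eq_self_iff, E.surjective.forall, E.le_iff_le]

theorem FacePairs.nonempty_orderIso (J : Set ι) (h : CombEquiv C D) :
    Nonempty (FacePairs J C ≃o FacePairs J D) := by
  obtain ⟨E⟩ := h
  exact ⟨{
    toFun x := ⟨(x.1.1, E x.1.2), x.2.trans (FaceLattice.orderIso_eq_self_iff E _).symm⟩
    invFun x := ⟨(x.1.1, E.symm x.1.2), x.2.trans (FaceLattice.orderIso_eq_self_iff E.symm _).symm⟩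
    left_inv x := Subtype.ext (Prod.ext rfl (E.symm_apply_apply _))
    right_inv x := Subtype.ext (Prod.ext rfl (E.apply_symm_apply _))
    map_rel_iff' := and_congr Iff.rfl E.le_iff_le }⟩

namespace SplitsOver

variable [Fintype ι] {d d' : ℕ} {lam : ι → ℝ} {c : Fin d → ℝ} {Q : Set (Fin d → ℝ)}
  {P : Set (Fin q → ℝ)}

theorem nonempty_faceLattice_orderIso (h : SplitsOver lam c Q P) :
    Nonempty (FaceLattice P ≃o FacePairs (Function.support lam) Q) := by
  obtain ⟨v, p, C, hP, hCQ⟩ := h.exists_splitHull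
  obtain ⟨e⟩ := hP.nonempty_faceLattice_orderIso
  obtain ⟨E⟩ := FacePairs.nonempty_orderIso (Function.support lam)
    (hCQ.combEquiv hP.isPolytope_base.convex)
  exact ⟨e.trans E⟩

theorem combEquiv {lam' : ι → ℝ} {c' : Fin d' → ℝ} {Q' : Set (Fin d' → ℝ)} {R : Set (Fin r → ℝ)}
    (h : SplitsOver lam c Q P) (h' : SplitsOver lam' c' Q' R)
    (hlam : Function.support lam = Function.support lam') (hQ : CombEquiv Q Q') :
    CombEquiv P R := by
  obtain ⟨e⟩ := h.nonempty_faceLattice_orderIso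
  obtain ⟨e'⟩ := h'.nonempty_faceLattice_orderIso
  obtain ⟨E⟩ := FacePairs.nonempty_orderIso (Function.support lam) hQ
  rw [← hlam] at e'
  exact ⟨(e.trans E).trans e'.symm⟩

end SplitsOver

end FaceLattices

section Counting

variable {q : ℕ} {C : Set (Fin q → ℝ)}

theorem eq_convexHull_of_isExposed_convexHull {T F : Set (Fin q → ℝ)}
    (hF : IsExposed ℝ (convexHull ℝ T) F) : F = convexHull ℝ (T ∩ F) := by
  obtain ⟨f, hf, rfl⟩ := exists_affineMap_of_isExposed hF
  rw [← sep_eq_inter_sep (subset_convexHull ℝ T)]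
  exact sep_eq_zero_convexHull fun x hx => hf x (subset_convexHull ℝ T hx)

theorem IsPolytope.finite_faceLattice (hC : IsPolytope C) : Finite (FaceLattice C) := by
  obtain ⟨t, -, rfl⟩ := hC
  have hfin : {F | IsExposed ℝ (convexHull ℝ (t : Set (Fin q → ℝ))) F}.Finite :=
    (t.finite_toSet.powerset.image (convexHull ℝ)).subset fun F hF =>
      ⟨_, inter_subset_left, (eq_convexHull_of_isExposed_convexHull hF).symm⟩
  exact hfin.to_subtype

theorem IsPolytope.one_lt_ncard_proper_faces (hC : IsPolytope C) (hd : 1 ≤ dim C) :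
    1 < {G : FaceLattice C | G.1 ≠ C}.ncard := by
  have := hC.finite_faceLattice
  obtain ⟨x, hx⟩ := hC.isCompact.extremePoints_nonempty hC.nonempty
  have hxC : {x} ≠ C := by
    rintro rfl
    rw [dim, vectorSpan_singleton, finrank_bot] at hd
    exact Nat.not_succ_le_zero 0 hd
  exact (one_lt_ncard (toFinite _)).mpr ⟨⟨∅, isExposed_empty⟩, hC.nonempty.ne_empty.symm,
    ⟨{x}, hC.isExposed_singleton hx⟩, hxC,
    fun h => (singleton_ne_empty x) (congrArg Subtype.val h).symm⟩

theorem ncard_supersets {ι : Type*} [Finite ι] (J : Set ι) :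
    {A : Set ι | J ⊆ A}.ncard = 2 ^ Jᶜ.ncard := by
  have himage : compl '' {A : Set ι | J ⊆ A} = 𝒫 Jᶜ := by
    rw [compl_image]
    ext A
    exact subset_compl_comm
  rw [← ncard_powerset, ← himage, ncard_image_of_injective _ compl_injective]

theorem card_facePairs {ι : Type} [Fintype ι] (J : Set ι) (hC : IsPolytope C) :
    Nat.card (FacePairs J C) + 2 ^ Jᶜ.ncard * {G : FaceLattice C | G.1 ≠ C}.ncard =
      2 ^ Jᶜ.ncard + 2 ^ Fintype.card ι * {G : FaceLattice C | G.1 ≠ C}.ncard := by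
  have := hC.finite_faceLattice
  let whole : FaceLattice C := ⟨C, IsExposed.refl C⟩
  let S : Set (Set ι) := {A | J ⊆ A}
  let properFaces : Set (FaceLattice C) := {G | G.1 ≠ C}
  have hpairs : {x : Set ι × FaceLattice C | J ⊆ x.1 ↔ x.2.1 = C} =
      S ×ˢ {whole} ∪ Sᶜ ×ˢ properFaces := by
    ext ⟨A, G⟩
    simp only [S, properFaces, whole, mem_ofPred_eq, mem_union, mem_prod, mem_compl_iff,
      mem_singleton_iff, Subtype.ext_iff]
    tauto
  have hdisj : Disjoint (S ×ˢ {whole}) (Sᶜ ×ˢ properFaces) :=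
    disjoint_compl_right.set_prod_left _ _
  have hS : S.ncard + Sᶜ.ncard = 2 ^ Fintype.card ι := by
    rw [ncard_add_ncard_compl, Nat.card_eq_fintype_card, Fintype.card_set]
  have hcard : Nat.card (FacePairs J C) = S.ncard + Sᶜ.ncard * properFaces.ncard := by
    calc Nat.card (FacePairs J C)
        = (S ×ˢ {whole} ∪ Sᶜ ×ˢ properFaces).ncard := by rw [← hpairs]; rfl
      _ = S.ncard + Sᶜ.ncard * properFaces.ncard := by
        rw [ncard_union_eq hdisj, ncard_prod, ncard_prod, ncard_singleton, mul_one]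
  rw [hcard, ← hS, ← ncard_supersets]
  ring

theorem SplitsOver.ncard_compl_support_eq {ι κ : Type} [Fintype ι] [Fintype κ] {d r : ℕ}
    {lam : ι → ℝ} {mu : κ → ℝ} {c c' : Fin d → ℝ} {Q : Set (Fin d → ℝ)} {P : Set (Fin q → ℝ)}
    {R : Set (Fin r → ℝ)} (h : SplitsOver lam c Q P) (h' : SplitsOver mu c' Q R)
    (hcard : Fintype.card ι = Fintype.card κ) (hQ : IsPolytope Q) (hd : 1 ≤ dim Q)
    (hPR : CombEquiv P R) :
    (Function.support lam)ᶜ.ncard = (Function.support mu)ᶜ.ncard := by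
  obtain ⟨e⟩ := h.nonempty_faceLattice_orderIso
  obtain ⟨e'⟩ := h'.nonempty_faceLattice_orderIso
  obtain ⟨E⟩ := hPR
  have hP := card_facePairs (Function.support lam) hQ
  have hR := card_facePairs (Function.support mu) hQ
  rw [← Nat.card_congr e.toEquiv] at hP
  rw [← Nat.card_congr e'.toEquiv, ← Nat.card_congr E.toEquiv, ← hcard] at hR
  obtain ⟨M, hM⟩ := Nat.exists_eq_add_of_lt (hQ.one_lt_ncard_proper_faces hd)
  have hpow : 2 ^ (Function.support lam)ᶜ.ncard * (M + 1) =
      2 ^ (Function.support mu)ᶜ.ncard * (M + 1) := by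
    rw [hM] at hP hR
    linarith
  exact Nat.pow_right_injective le_rfl (Nat.eq_of_mul_eq_mul_right M.succ_pos hpow)

end Counting

section Classification

theorem exists_affEquiv_fullDim {q : ℕ} (P : Set (Fin q → ℝ)) :
    ∃ T : Set (Fin (dim P) → ℝ), AffEquiv P T := by
  let e := (Module.finBasis ℝ (vectorSpan ℝ P)).equivFun
  obtain ⟨L, hL⟩ := LinearMap.exists_extend e.toLinearMap
  have hinj : InjOn L P := fun x hx y hy hxy => by
    have hu : e ⟨x - y, vsub_mem_vectorSpan ℝ hx hy⟩ = L (x - y) :=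
      (LinearMap.congr_fun hL ⟨x - y, vsub_mem_vectorSpan ℝ hx hy⟩).symm
    rw [map_sub, hxy, sub_self, LinearEquiv.map_eq_zero_iff] at hu
    exact sub_eq_zero.mp (congrArg Subtype.val hu)
  exact ⟨L '' P, L.toAffineMap, hinj.bijOn_image⟩

variable {q d n m i j : ℕ} {P : Set (Fin q → ℝ)} {Q : Set (Fin d → ℝ)}

theorem IsBasisPolytope.isPolytope {e : ℕ} {s : Finset (Fin q → ℝ)} {B : Set (Fin e → ℝ)}
    (h : IsBasisPolytope P s B) (hP : IsPolytope P) : IsPolytope B := by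
  obtain ⟨π, -, -, rfl⟩ := h
  exact hP.image π.toAffineMap

theorem IsSpecialSimplex.exists_isPyramidOverSum {s : Finset (Fin q → ℝ)}
    (hs : IsSpecialSimplex m P s) (hP : IsPolytope P) (hd : m < dim P) (hmeek : IsMeek P s) {e : ℕ}
    {B : Set (Fin e → ℝ)} (hB : IsBasisPolytope P s B) (hBQ : AffEquiv B Q) :
    dim P = dim Q + m ∧ ∃ (i j : ℕ) (R : Set (Fin (j + d + i) → ℝ)),
      0 < j ∧ i + j = m ∧ IsPyramidOverSum i j Q R ∧ AffEquiv P R := by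
  obtain ⟨lam, p, C, h⟩ := hs.exists_splitHull hP hd hmeek
  have hcard : Fintype.card s = m + 1 := (Fintype.card_coe s).trans hs.1
  obtain ⟨φ, hφ⟩ := (h.affEquiv_of_isBasisPolytope Subtype.range_coe.symm hB).trans hBQ
  have hsplit : SplitsOver lam (φ p) Q P := ⟨_, p, C, φ, h, hφ, rfl⟩
  exact ⟨hsplit.dim_eq hcard, hsplit.exists_isPyramidOverSum hcard⟩

theorem support_sumElim_zero {α β : Type*} {lam : α → ℝ} (h : ∀ k, lam k ≠ 0) :
    Function.support (Sum.elim lam (0 : β → ℝ)) = range Sum.inl := by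
  ext (k | k)
  · simp [h k]
  · simp

namespace IsPyramidOverSum

variable {R : Set (Fin (j + d + i) → ℝ)}

theorem isPolytope (h : IsPyramidOverSum i j Q R) (hj : 0 < j) (hQ : IsPolytope Q) :
    IsPolytope R := by
  obtain ⟨lam, c, -, hR⟩ := h.exists_splitsOver hj hQ
  exact hR.isPolytope

theorem dim_eq (h : IsPyramidOverSum i j Q R) (hj : 0 < j) (hQ : IsPolytope Q) :
    dim R = dim Q + (i + j) := by
  obtain ⟨lam, c, -, hR⟩ := h.exists_splitsOver hj hQ
  exact hR.dim_eq (by rw [Fintype.card_sum, Fintype.card_fin, Fintype.card_fin]; omega)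

theorem exists_isSpecialSimplex (h : IsPyramidOverSum i j Q R) (hj : 0 < j) (hQ : IsPolytope Q)
    (hRP : AffEquiv R P) :
    ∃ s, IsSpecialSimplex (i + j) P s ∧ IsMeek P s ∧
      ∃ (e : ℕ) (B : Set (Fin e → ℝ)), IsBasisPolytope P s B ∧ AffEquiv B Q := by
  obtain ⟨lam, c, -, hR⟩ := h.exists_splitsOver hj hQ
  exact (hR.of_affEquiv hRP).exists_isSpecialSimplex
    (by rw [Fintype.card_sum, Fintype.card_fin, Fintype.card_fin]; omega)

theorem isMeekOver (h : IsPyramidOverSum i j Q R) (hj : 0 < j) (hQ : IsPolytope Q)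
    (hRP : AffEquiv R P) : IsMeekOver (dim Q + (i + j)) (i + j) Q P := by
  have hR := h.isPolytope hj hQ
  have hP := hRP.isPolytope hR
  obtain ⟨s, hs, hmeek, e, B, hB, hBQ⟩ := h.exists_isSpecialSimplex hj hQ hRP
  exact ⟨hP, (hRP.dim_eq hR.convex).symm.trans (h.dim_eq hj hQ), s, hs, hmeek, e, B, hB,
    hBQ.combEquiv (hB.isPolytope hP).convex⟩

theorem combEquiv {e : ℕ} {B : Set (Fin e → ℝ)} {R' : Set (Fin (j + e + i) → ℝ)}
    (h : IsPyramidOverSum i j Q R) (h' : IsPyramidOverSum i j B R') (hj : 0 < j)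
    (hQ : IsPolytope Q) (hB : IsPolytope B) (hQB : CombEquiv Q B) : CombEquiv R R' := by
  obtain ⟨lam, c, hlam, hR⟩ := h.exists_splitsOver hj hQ
  obtain ⟨mu, c', hmu, hR'⟩ := h'.exists_splitsOver hj hB
  refine hR.combEquiv hR' ?_ hQB
  rw [support_sumElim_zero fun k => (hlam k).ne', support_sumElim_zero fun k => (hmu k).ne']

theorem eq_of_combEquiv {i' j' : ℕ} {R' : Set (Fin (j' + d + i') → ℝ)}
    (h : IsPyramidOverSum i j Q R) (h' : IsPyramidOverSum i' j' Q R') (hj : 0 < j) (hj' : 0 < j')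
    (hij : i + j = i' + j') (hQ : IsPolytope Q) (hd : 1 ≤ dim Q) (hRR : CombEquiv R R') :
    i = i' := by
  obtain ⟨lam, c, hlam, hR⟩ := h.exists_splitsOver hj hQ
  obtain ⟨mu, c', hmu, hR'⟩ := h'.exists_splitsOver hj' hQ
  have hcard : Fintype.card (Fin (j + 1) ⊕ Fin i) = Fintype.card (Fin (j' + 1) ⊕ Fin i') := by
    simp only [Fintype.card_sum, Fintype.card_fin]
    omega
  have hncard := hR.ncard_compl_support_eq hR' hcard hQ hd hRR
  rwa [support_sumElim_zero fun k => (hlam k).ne', support_sumElim_zero fun k => (hmu k).ne',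
    compl_range_inl, compl_range_inl,
    ncard_range_of_injective Sum.inr_injective, ncard_range_of_injective Sum.inr_injective,
    Nat.card_fin, Nat.card_fin] at hncard

end IsPyramidOverSum

theorem IsMeekOver.exists_combEquiv (h : IsMeekOver n m Q P) (hmn : m < n) (hQ : IsPolytope Q) :
    ∃ (i j : ℕ) (R : Set (Fin (j + d + i) → ℝ)),
      0 < j ∧ i + j = m ∧ IsPyramidOverSum i j Q R ∧ CombEquiv P R := by
  obtain ⟨hP, rfl, s, hs, hmeek, e, B, hB, hBQ⟩ := h
  obtain ⟨-, i, j, R, hj, hij, hR, hPR⟩ :=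
    hs.exists_isPyramidOverSum hP hmn hmeek hB ⟨AffineMap.id ℝ _, bijOn_id B⟩
  obtain ⟨R', hR'⟩ := SpecialSimplex.exists_isPyramidOverSum i hj hQ
  exact ⟨i, j, R', hj, hij, hR', (hPR.combEquiv hP.convex).trans
    (hR.combEquiv hR' hj (hB.isPolytope hP) hQ hBQ)⟩

theorem exists_isMeek_iff (hP : IsPolytope P) (hm : m < dim P) :
    (∃ s, IsSpecialSimplex m P s ∧ IsMeek P s) ↔
      ∃ (d : ℕ) (Q : Set (Fin d → ℝ)), IsPolytope Q ∧ dim Q + m = dim P ∧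
        ∃ (i j : ℕ) (R : Set (Fin (j + d + i) → ℝ)),
          0 < j ∧ i + j = m ∧ IsPyramidOverSum i j Q R ∧ AffEquiv P R := by
  constructor
  · rintro ⟨s, hs, hmeek⟩
    obtain ⟨d, Q, hQ⟩ := exists_isBasisPolytope P s
    obtain ⟨hdim, hR⟩ := hs.exists_isPyramidOverSum hP hm hmeek hQ ⟨AffineMap.id ℝ _, bijOn_id Q⟩
    exact ⟨d, Q, hQ.isPolytope hP, hdim.symm, hR⟩
  · rintro ⟨d, Q, hQ, -, i, j, R, hj, rfl, hR, hPR⟩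
    obtain ⟨s, hs, hmeek, -⟩ := hR.exists_isSpecialSimplex hj hQ (hPR.symm hP.convex)
    exact ⟨s, hs, hmeek⟩

theorem exists_isMeek_isBasisPolytope_affEquiv_iff (hP : IsPolytope P) (hm : m < dim P)
    (hQ : IsPolytope Q) :
    (∃ s, IsSpecialSimplex m P s ∧ IsMeek P s ∧
        ∃ (e : ℕ) (B : Set (Fin e → ℝ)), IsBasisPolytope P s B ∧ AffEquiv B Q) ↔
      dim Q + m = dim P ∧ ∃ (i j : ℕ) (R : Set (Fin (j + d + i) → ℝ)),
        0 < j ∧ i + j = m ∧ IsPyramidOverSum i j Q R ∧ AffEquiv P R := by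
  constructor
  · rintro ⟨s, hs, hmeek, e, B, hB, hBQ⟩
    obtain ⟨hdim, hR⟩ := hs.exists_isPyramidOverSum hP hm hmeek hB hBQ
    exact ⟨hdim.symm, hR⟩
  · rintro ⟨-, i, j, R, hj, rfl, hR, hPR⟩
    exact hR.exists_isSpecialSimplex hj hQ (hPR.symm hP.convex)

theorem exists_isMeekOver_combEquiv_iff (hmn : m < n) (hQ : IsPolytope Q) (hd : dim Q + m = n) :
    (∃ (q' : ℕ) (P' : Set (Fin q' → ℝ)), IsMeekOver n m Q P' ∧ CombEquiv P P') ↔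
      ∃ (i j : ℕ) (R : Set (Fin (j + d + i) → ℝ)),
        0 < j ∧ i + j = m ∧ IsPyramidOverSum i j Q R ∧ CombEquiv P R := by
  constructor
  · rintro ⟨q', P', hP', hPP'⟩
    obtain ⟨i, j, R, hj, hij, hR, hPR⟩ := hP'.exists_combEquiv hmn hQ
    exact ⟨i, j, R, hj, hij, hR, hPP'.trans hPR⟩
  · rintro ⟨i, j, R, hj, rfl, hR, hPR⟩
    exact ⟨_, R, hd ▸ hR.isMeekOver hj hQ ⟨AffineMap.id ℝ _, bijOn_id R⟩, hPR⟩

theorem exists_isPyramidOverSum_affEquiv_fullDim (hQ : IsPolytope Q) (hj : 0 < j)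
    (hd : dim Q + (i + j) = n) :
    ∃ (R : Set (Fin (j + d + i) → ℝ)) (T : Set (Fin n → ℝ)),
      IsPyramidOverSum i j Q R ∧ AffEquiv R T := by
  obtain ⟨R, hR⟩ := exists_isPyramidOverSum i hj hQ
  obtain rfl : dim R = n := (hR.dim_eq hj hQ).trans hd
  obtain ⟨T, hT⟩ := exists_affEquiv_fullDim R
  exact ⟨R, T, hR, hT⟩

theorem exists_isMeekOver_representatives (hmn : m < n) (hQ : IsPolytope Q)
    (hd : dim Q + m = n) :
    ∃ T : Fin m → Set (Fin n → ℝ),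
      (∀ k, IsMeekOver n m Q (T k)) ∧
      (∀ k l, CombEquiv (T k) (T l) → k = l) ∧
      ∀ (q : ℕ) (P : Set (Fin q → ℝ)), IsMeekOver n m Q P → ∃ k, CombEquiv P (T k) := by
  have hadd : ∀ k : Fin m, (m - (k + 1)) + (k + 1 : ℕ) = m := fun k => Nat.sub_add_cancel k.2
  choose R T hR hRT using fun k : Fin m => exists_isPyramidOverSum_affEquiv_fullDim hQ
    (i := m - (k + 1)) (Nat.succ_pos k) ((hadd k).symm ▸ hd)
  have hcomb : ∀ k, CombEquiv (R k) (T k) := fun k =>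
    (hRT k).combEquiv ((hR k).isPolytope (Nat.succ_pos k) hQ).convex
  refine ⟨T, fun k => ?_, fun k l hkl => ?_, fun q P hP => ?_⟩
  · have hk := (hR k).isMeekOver (Nat.succ_pos k) hQ (hRT k)
    rwa [hadd, hd] at hk
  · have hi := (hR k).eq_of_combEquiv (hR l) (Nat.succ_pos k) (Nat.succ_pos l)
      ((hadd k).trans (hadd l).symm) hQ (by omega) (((hcomb k).trans hkl).trans (hcomb l).symm)
    exact Fin.ext (by have := hadd k; have := hadd l; omega)
  · obtain ⟨i, j, R', hj, hij, hR', hPR'⟩ := hP.exists_combEquiv hmn hQ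
    obtain ⟨k, rfl⟩ := Nat.exists_eq_succ_of_ne_zero hj.ne'
    obtain rfl : i = m - (k + 1) := Nat.eq_sub_of_add_eq hij
    have hR'R := hR'.combEquiv (hR ⟨k, by omega⟩) hj hQ hQ ⟨OrderIso.refl _⟩
    exact ⟨_, hPR'.trans (hR'R.trans (hcomb _))⟩

end Classification

end SpecialSimplex

open SpecialSimplex in
theorem mainTheorem1 (n m : ℕ) (hm : 1 ≤ m) (hmn : m < n) :
    -- classification of the meek polytopes themselves
    (∀ (q : ℕ) (P : Set (Fin q → ℝ)), IsPolytope P → dim P = n →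
      ((∃ s, IsSpecialSimplex m P s ∧ IsMeek P s) ↔
        ∃ (d : ℕ) (Q : Set (Fin d → ℝ)), IsPolytope Q ∧ dim Q + m = n ∧
          ∃ (i j : ℕ) (R : Set (Fin (j + d + i) → ℝ)),
            0 < j ∧ i + j = m ∧ IsPyramidOverSum i j Q R ∧ AffEquiv P R)) ∧
    -- the polytope `Q` here is precisely the basis polytope
    (∀ (q : ℕ) (P : Set (Fin q → ℝ)), IsPolytope P → dim P = n →
      ∀ (d : ℕ) (Q : Set (Fin d → ℝ)), IsPolytope Q →
        ((∃ s, IsSpecialSimplex m P s ∧ IsMeek P s ∧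
            ∃ (e : ℕ) (B : Set (Fin e → ℝ)), IsBasisPolytope P s B ∧ AffEquiv B Q) ↔
          dim Q + m = n ∧ ∃ (i j : ℕ) (R : Set (Fin (j + d + i) → ℝ)),
            0 < j ∧ i + j = m ∧ IsPyramidOverSum i j Q R ∧ AffEquiv P R)) ∧
    -- combinatorial classification for a given basis polytope
    (∀ (d : ℕ) (Q : Set (Fin d → ℝ)), IsPolytope Q → dim Q + m = n →
      ∀ (q : ℕ) (P : Set (Fin q → ℝ)), IsPolytope P → dim P = n →
        ((∃ (q' : ℕ) (P' : Set (Fin q' → ℝ)), IsMeekOver n m Q P' ∧ CombEquiv P P') ↔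
          ∃ (i j : ℕ) (R : Set (Fin (j + d + i) → ℝ)),
            0 < j ∧ i + j = m ∧ IsPyramidOverSum i j Q R ∧ CombEquiv P R)) ∧
    -- for a given basis polytope there are exactly `m` combinatorial types
    (∀ (d : ℕ) (Q : Set (Fin d → ℝ)), IsPolytope Q → dim Q + m = n →
      ∃ T : Fin m → Set (Fin n → ℝ),
        (∀ k, IsMeekOver n m Q (T k)) ∧
        (∀ k l, CombEquiv (T k) (T l) → k = l) ∧
        ∀ (q : ℕ) (P : Set (Fin q → ℝ)), IsMeekOver n m Q P → ∃ k, CombEquiv P (T k)) := by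
  exact ⟨fun q P hP hd => hd ▸ exists_isMeek_iff hP (hd ▸ hmn),
    fun q P hP hd d Q hQ => hd ▸ exists_isMeek_isBasisPolytope_affEquiv_iff hP (hd ▸ hmn) hQ,
    fun d Q hQ hdQ q P _ _ => exists_isMeekOver_combEquiv_iff hmn hQ hdQ,
    fun d Q hQ hdQ => exists_isMeekOver_representatives hmn hQ hdQ⟩
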